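/- **Setting.** There are $K\ge 1$ arms; in round $t=0,\dots,T-1$ arm $a$ produces a reward $X_a(t)\in[0,1]$, where all rewards are independent and those of arm $a$ share a law with mean $\mu_a$. In round $t$ a finite set of players is present (a deterministic schedule); each chooses an arm, without communication. Players choosing the same arm collide, learn this, and get no reward; a player who does not collide observes the reward of her arm. With $N_t$ the number of players present, $\mu_{(1)}\ge\dots\ge\mu_{(K)}$ the sorted means, $\mu_j(t)$ the mean of the arm chosen by player $j$ and $\eta_j(t)\in\{0,1\}$ her collision indicator, the regret is $$R=\sum_{t<T}\Big(\sum_{i\le N_t}\mu_{(i)}-\sum_{j\text{ present}}\mu_j(t)(1-\eta_j(t))\Big).$$ **Algorithm (Dynamic Musical Chairs with parameters $T_0\le T_1$).** Time is divided into epochs of $T_1$ rounds, known to all players. In the first $T_0$ rounds of an epoch (the learning rounds) each player chooses arms uniformly at random, counts her collisions $C$ and records the empirical mean of each arm over her collision-free observations. She then sorts the arms by decreasing empirical mean into an array $A$ and sets $N^*=\mathrm{round}\big(\log\frac{T_0-C}{T_0}/\log(1-\frac1K)+1\big)$ (at most $K$), with $N^*=K$ if $C=T_0$. From then on, in each round she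 chooses an arm uniformly from $A[1],\dots,A[N^*]$ until she first does so without collision, and keeps that arm until the end of the epoch. A player who enters during an epoch chooses arms uniformly at random until the next epoch starts. **Theorem.** Let $T,x\ge1$, $N_m\le K$, $\delta\in(0,1)$ and $\epsilon>0$. Suppose that at most $N_m$ players are present in any round, that players enter or leave only outside the learning periods (epoch boundaries are allowed), that the total number of entries and departures during the $T$ rounds is at most $x$, and that $\mu_{(i)}-\mu_{(i+1)}\ge\epsilon$ for all $i\le N_m$ with $i+1\le K$. Put $$T_0=\Big\lceil\max\Big(\tfrac K2\ln\tfrac{2K^2}{\delta/(2T)},\ \tfrac{16K}{\epsilon^2}\ln\tfrac{4K^2}{\delta/(2T)},\ \tfrac{K^2\ln(4T/\delta)}{0.02}\Big)\Big\rceil .$$ Let $\tilde O$ hide factors that are polynomial in $K$ and $1/\epsilon$ and polylogarithmic in $T$ and $1/\delta$, with exponents that are absolute constants. Then: 1. $T_0=\tilde O(1)$. 2. For $0\le T_f\le e^2K$, the epoch length $T_1=\max\Big(T_0,\Big\lceil\sqrt{T(T_0+2T_f)/x}\Big\rceil\Big)$ gives $O(\sqrt{xT})$ epochs and, if $x\le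 T$, at least $\sqrt{xT}/\tilde O(1)$ epochs. 3. For each epoch length $T_1$ of item 2, and also for each $T_1\ge T_0$ for which the number of epochs $\lceil T/T_1\rceil$ lies between $a\sqrt{xT}$ and $b\sqrt{xT}$, where $a,b>0$ are arbitrary fixed constants (on which only the constant factor in the bound depends), the following holds. Let $G$ be the event that, in every epoch whose learning phase ends within the $T$ rounds, every player present in that phase obtains $N^*$ equal to the true number of players and an array $A$ that lists arm $a$ before arm $a'$ whenever $\mu_a-\mu_{a'}\ge\epsilon$. Then $\Pr(G)\ge1-\delta$, and the regret of Dynamic Musical Chairs is integrable conditionally on $G$ and satisfies $$\mathbb E[R\mid G]\le\tilde O\big(\sqrt{xT}\big),$$ where the expectation is over the rewards and the randomness of the algorithm. -/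

import Mathlib

open MeasureTheory ProbabilityTheory

namespace DMC

noncomputable section

/-- A uniform draw from `{0, …, n - 1}` obtained from a uniform seed `u ∈ [0, 1]`
(the minimum only matters at the single seed `u = 1`). -/
def sample (n : ℕ) (u : ℝ) : ℕ := min ⌊(n : ℝ) * u⌋₊ (n - 1)

/-- The arm played by an exploring player: uniform on all `K` arms. -/
def exploreArm (K : ℕ) [NeZero K] (u : ℝ) : Fin K := Fin.ofNat K (sample K u)

/-- Arms sorted by decreasing `m`; `ranking m 0` is an arm with the largest value of `m`.
Ties are broken by the index of the arm. -/
def ranking {K : ℕ} (m : Fin K → ℝ) : Equiv.Perm (Fin K) := Tuple.sort (fun a => -m a)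

/-- The sorted array of arms `A` lists `a` before `b` whenever the mean of `a` exceeds the mean of
`b` by at least `ε`. -/
def IsCorrectRanking {K : ℕ} (mean : Fin K → ℝ) (ε : ℝ) (A : Equiv.Perm (Fin K)) : Prop :=
  ∀ a b, ε ≤ mean a - mean b → A.symm a < A.symm b

/-- Player `i` collides if another present player chose the same arm. -/
def Collides {ι : Type*} {K : ℕ} (present : Finset ι) (arms : ι → Fin K) (i : ι) : Prop :=
  ∃ j ∈ present, j ≠ i ∧ arms j = arms i

/-! ### The learning phase

Rounds are `0, 1, 2, …`. Epoch `k` consists of the rounds `k * T1, …, (k + 1) * T1 - 1`; its first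
`T0` rounds are learning rounds, in which every present player explores.  `active t` is the set of
players present at round `t`, `u i t` is the seed of player `i` at round `t`, and `X a t` is the
reward produced by arm `a` at round `t`. -/

section Learning

variable {ι : Type*} {K : ℕ} [NeZero K] (T0 T1 : ℕ) (active : ℕ → Finset ι) (u : ι → ℕ → ℝ)
  (X : Fin K → ℕ → ℝ)

/-- The learning rounds of epoch `k`. -/
def learningWindow (k : ℕ) : Finset ℕ := Finset.Ico (k * T1) (k * T1 + T0)

open Classical in
/-- Number of collisions of player `i` in the learning phase of epoch `k`. -/
def collisionCount (K : ℕ) [NeZero K] (k : ℕ) (i : ι) : ℕ :=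
  ((learningWindow T0 T1 k).filter fun t =>
    Collides (active t) (fun j => exploreArm K (u j t)) i).card

open Classical in
/-- The learning rounds of epoch `k` in which player `i` observes a reward of arm `a`. -/
def obsRounds (k : ℕ) (i : ι) (a : Fin K) : Finset ℕ :=
  (learningWindow T0 T1 k).filter fun t =>
    exploreArm K (u i t) = a ∧ ¬ Collides (active t) (fun j => exploreArm K (u j t)) i

/-- Empirical mean reward of arm `a` seen by player `i` in the learning phase of epoch `k`. -/
def empMean (k : ℕ) (i : ι) (a : Fin K) : ℝ :=
  (∑ t ∈ obsRounds T0 T1 active u k i a, X a t) / ((obsRounds T0 T1 active u k i a).card : ℝ)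

/-- Player `i`'s estimate of the number of players after the learning phase of epoch `k`
(at most `K`, since it is used as a number of arms). -/
def playerEstimate (K : ℕ) [NeZero K] (k : ℕ) (i : ι) : ℕ :=
  if collisionCount T0 T1 active u K k i = T0 then K
  else min K (round (Real.log (((T0 : ℝ) - collisionCount T0 T1 active u K k i) / T0) /
    Real.log (1 - 1 / (K : ℝ)) + 1)).toNat

/-! ### The algorithm -/

/-- Player `i` has been present since the beginning of the epoch containing round `t`, hence runs
Musical Chairs in that epoch. A player who came later explores until the next epoch. -/
def RunsMC (i : ι) (t : ℕ) : Prop := ∀ s, t / T1 * T1 ≤ s → s ≤ t → i ∈ active s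

open Classical in
/-- The arm chosen by player `i` at round `t`, when `fixed j` is the arm player `j` is fixed on. -/
def choice (fixed : ι → Option (Fin K)) (t : ℕ) (i : ι) : Fin K :=
  if t % T1 < T0 ∨ ¬ RunsMC T1 active i t then exploreArm K (u i t)
  else (fixed i).getD (ranking (empMean T0 T1 active u X (t / T1) i)
    (Fin.ofNat K (sample (playerEstimate T0 T1 active u K (t / T1) i) (u i t))))

open Classical in
/-- The arm on which each player is fixed just before round `t` (`none` if not fixed). Nobody is
fixed when the Musical Chairs phase starts; a player becomes fixed on the first arm that she
chooses without a collision in that phase, and remains fixed until the end of the epoch. -/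
def fixedArm : ℕ → ι → Option (Fin K)
  | 0 => fun _ => none
  | t + 1 => fun i =>
    if (t + 1) % T1 ≤ T0 then none
    else if RunsMC T1 active i t ∧
        ¬ Collides (active t) (choice T0 T1 active u X (fixedArm t) t) i then
      some (choice T0 T1 active u X (fixedArm t) t i)
    else fixedArm t i

/-- The arm chosen by player `i` at round `t` under Dynamic Musical Chairs. -/
def action (t : ℕ) (i : ι) : Fin K :=
  choice T0 T1 active u X (fixedArm T0 T1 active u X t) t i

/-- In a learning round the action is exploration, so that the statistics above are those of the
arms actually played. -/
theorem action_of_learning {t : ℕ} (h : t % T1 < T0) (i : ι) :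
    action T0 T1 active u X t i = exploreArm K (u i t) := by
  simp [action, choice, h]

open Classical in
/-- The regret over `T` rounds, when the arms have the expected rewards `mean`. -/
def regret (mean : Fin K → ℝ) (T : ℕ) : ℝ :=
  ∑ t ∈ Finset.range T,
    ((∑ j : Fin K, if (j : ℕ) < (active t).card then mean (ranking mean j) else 0) -
      ∑ i ∈ active t,
        mean (action T0 T1 active u X t i) *
          (1 - if Collides (active t) (action T0 T1 active u X t) i then 1 else 0))

end Learning

/-! ### The stochastic model -/

/-- The rewards `X a t` of arm `a` have law `ν a` on `[0, 1]`, the seeds `W i t` of the players are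
uniform on `[0, 1]`, and all of them are independent. -/
structure IsModel {Ω ι : Type*} [MeasurableSpace Ω] {K : ℕ} (P : Measure Ω)
    (ν : Fin K → Measure ℝ) (X : Fin K → ℕ → Ω → ℝ) (W : ι → ℕ → Ω → ℝ) : Prop where
  measurable_reward : ∀ a t, Measurable (X a t)
  measurable_seed : ∀ i t, Measurable (W i t)
  reward_law : ∀ a t, P.map (X a t) = ν a
  reward_range : ∀ a, ν a (Set.Icc 0 1) = 1
  seed_law : ∀ i t, P.map (W i t) = volume.restrict (Set.Icc (0 : ℝ) 1)
  indep : iIndepFun (Sum.elim (fun z : Fin K × ℕ => X z.1 z.2) (fun z : ι × ℕ => W z.1 z.2)) P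

/-- The admissible schedules of players: at most `Nm` players are present in each of the `T` rounds,
nobody enters or leaves between two learning rounds of the same epoch, and the total number of
entries and departures during the `T` rounds is at most `x`. -/
structure IsSchedule {ι : Type*} [DecidableEq ι] (active : ℕ → Finset ι) (Nm T x T0 T1 : ℕ) :
    Prop where
  card_le : ∀ t < T, (active t).card ≤ Nm
  learning : ∀ t, t + 1 < T → 0 < (t + 1) % T1 → (t + 1) % T1 < T0 → active (t + 1) = active t
  changes : ∑ t ∈ Finset.range (T - 1), (symmDiff (active t) (active (t + 1))).card ≤ x

/-- The event that, in every epoch whose learning phase ends within the `T` rounds, each player who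
took part in it has learned the number of players and a correct ranking. -/
def goodEvent {Ω ι : Type*} {K : ℕ} [NeZero K] (mean : Fin K → ℝ) (ε : ℝ) (T T0 T1 : ℕ)
    (active : ℕ → Finset ι) (X : Fin K → ℕ → Ω → ℝ) (W : ι → ℕ → Ω → ℝ) : Set Ω :=
  {ω | ∀ k, k * T1 + T0 ≤ T → ∀ i ∈ active (k * T1),
    playerEstimate T0 T1 active (fun i t => W i t ω) K k i = (active (k * T1)).card ∧
    IsCorrectRanking mean ε
      (ranking (empMean T0 T1 active (fun i t => W i t ω) (fun a t => X a t ω) k i))}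

/-! ### Parameters -/

/-- The number of learning rounds in each epoch. -/
def learningRounds (K T : ℕ) (ε δ : ℝ) : ℕ :=
  ⌈max ((K : ℝ) / 2 * Real.log (2 * (K : ℝ) ^ 2 / (δ / (2 * T))))
    (max (16 * (K : ℝ) / ε ^ 2 * Real.log (4 * (K : ℝ) ^ 2 / (δ / (2 * T))))
      ((K : ℝ) ^ 2 * Real.log (4 * T / δ) / 0.02))⌉₊

/-- The optimized epoch length, `Tf` being the expected time a player needs to get fixed. -/
def epochLength (T0 T x : ℕ) (Tf : ℝ) : ℕ :=
  max T0 ⌈Real.sqrt ((T : ℝ) * (T0 + 2 * Tf) / x)⌉₊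

/-- The number of epochs of length `T1` begun during `T` rounds. -/
def numEpochs (T T1 : ℕ) : ℕ := ⌈(T : ℝ) / T1⌉₊

/-- The factors hidden by soft-O: a constant, polynomial in `K` and `1 / ε`, polylogarithmic in `T`
and `1 / δ`. -/
def softFactor (C : ℝ) (p q r K T : ℕ) (ε δ : ℝ) : ℝ :=
  C * (K : ℝ) ^ p * (1 + 1 / ε) ^ q * (1 + Real.log (T / δ)) ^ r

end

end DMC

namespace DMC

/-! ### Rankings of the arms and the set of the best arms -/

section Ranking

variable {K : ℕ}

/-! The regret of one round never exceeds `K`, so it suffices to count the bad rounds. With `M`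
epochs, at most `M * T0` rounds are learning rounds and at most `x * min T1 T` lie in an epoch where
somebody enters or leaves. The remaining rounds are Musical Chairs rounds with a constant set of `N`
players.

There, on the good event, all players hold the same `N` best arms in the same order: a correct
ranking is exact wherever the true gaps are at least `ε`. Players fix on distinct best arms, so
while one is unfixed some best arm is free. She alone draws it with probability at least `(1/N) (1 -
1/N)^(N-1) ≥ 1/(eK)`. The good event involves only rewards and learning seeds, so conditioning on it
leaves the Musical Chairs seeds uniform and independent. The probability of remaining unfixed thus
decays geometrically (`IsModel.measureReal_unfixed_le`). Once everybody is fixed the regret of a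
round is zero, so these rounds cost `O(K^3)` per epoch (`IsModel.integral_regret_le`).

For the probability of the good event, Hoeffding's lemma and Markov's inequality are applied to sums
of functions of separate, hence independent, rounds. Knowing the non-collision frequency to within
`0.1/K` determines `N` after rounding (`round_log_div_log_eq`). For the empirical means, the
exponential moment of observation indicator times `±(X - μ) - ε/2` is bounded, which treats the
random number of observations, possibly zero, in one stroke. A player fails in one epoch with
probability at most `δ/T`, and `K ≤ T0` leaves at most `T` pairs in the union bound.

Finally, `M` and `x * min T1 T` (capped by `T`) are both of order `√(xT)` up to hidden factors, for
either choice of epoch length. -/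

theorem perm_apply_eq_of_forall_lt (τ : Equiv.Perm (Fin K)) (n : ℕ)
    (h : ∀ j j' : Fin K, (j : ℕ) < n → j < j' → τ j < τ j') (j : Fin K) (hj : (j : ℕ) < n) :
    τ j = j := by
  -- `τ` carries the elements below `j` exactly onto those below `τ j`; comparing cardinalities
  -- gives `τ j = j`.
  have hset : (Finset.Iio j).map τ.toEmbedding = Finset.Iio (τ j) := by
    ext a
    simp only [Finset.mem_map_equiv, Finset.mem_Iio]
    obtain ⟨b, rfl⟩ := τ.surjective a
    rw [Equiv.symm_apply_apply]
    refine ⟨fun hb => h b j (lt_trans hb hj) hb, fun hb => ?_⟩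
    by_contra hjb
    rcases (not_lt.1 hjb).eq_or_lt with rfl | hlt
    · exact lt_irrefl _ hb
    · exact lt_asymm hb (h j b hj hlt)
  have hcard := congrArg Finset.card hset
  rw [Finset.card_map, Fin.card_Iio, Fin.card_Iio] at hcard
  exact Fin.ext hcard.symm

theorem antitone_ranking (m : Fin K → ℝ) : Antitone fun j => m (ranking m j) := by
  intro i j hij
  have := Tuple.monotone_sort (fun a => -m a) hij
  simpa [ranking] using this

/-- A correct ranking starts with the true one, as far as the means are well separated. -/
theorem IsCorrectRanking.apply_eq {mean : Fin K → ℝ} {ε : ℝ} {σ : Equiv.Perm (Fin K)} {n : ℕ}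
    (hσ : IsCorrectRanking mean ε σ)
    (hgap : ∀ (j : ℕ) (hj : j + 1 < K), j < n →
      ε ≤ mean (ranking mean ⟨j, Nat.lt_of_succ_lt hj⟩) - mean (ranking mean ⟨j + 1, hj⟩))
    (j : Fin K) (hj : (j : ℕ) < n) : σ j = ranking mean j := by
  -- This permutation sends the true rank of an arm to its position in `σ`. The gap after rank `j`,
  -- with monotonicity of the sorted means, separates `j` from every later rank.
  have key : ((ranking mean).trans σ.symm) j = j := by
    refine perm_apply_eq_of_forall_lt _ n (fun j j' hj hjj' => ?_) j hj
    apply hσ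
    have h1 : (j : ℕ) + 1 < K := lt_of_le_of_lt hjj' j'.2
    have h2 := hgap j h1 hj
    have h3 := antitone_ranking mean (show (⟨j + 1, h1⟩ : Fin K) ≤ j' from hjj')
    simp only [Fin.eta] at h2 h3
    linarith
  have := congrArg σ key
  simpa using this.symm

/-- The best `n` arms. -/
noncomputable def topArms (m : Fin K → ℝ) (n : ℕ) : Finset (Fin K) :=
  (Finset.univ.filter fun j : Fin K => (j : ℕ) < n).map (ranking m).toEmbedding

theorem mem_topArms {m : Fin K → ℝ} {n : ℕ} {a : Fin K} :
    a ∈ topArms m n ↔ ∃ j : Fin K, (j : ℕ) < n ∧ ranking m j = a := by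
  simp only [topArms, Finset.mem_map, Finset.mem_filter, Finset.mem_univ, true_and]
  rfl

theorem card_topArms (m : Fin K → ℝ) {n : ℕ} (hn : n ≤ K) : (topArms m n).card = n := by
  rw [topArms, Finset.card_map, Fin.card_filter_val_lt, min_eq_right hn]

theorem sum_topArms (m : Fin K → ℝ) (n : ℕ) :
    ∑ a ∈ topArms m n, m a = ∑ j : Fin K, if (j : ℕ) < n then m (ranking m j) else 0 := by
  rw [topArms, Finset.sum_map, Finset.sum_filter]; rfl

theorem sample_lt {n : ℕ} (hn : 0 < n) (u : ℝ) : sample n u < n :=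
  lt_of_le_of_lt (min_le_right _ _) (Nat.sub_lt hn one_pos)

theorem val_ofNat_sample [NeZero K] {n : ℕ} (hn : 0 < n) (hK : n ≤ K) (u : ℝ) :
    ((Fin.ofNat K (sample n u) : Fin K) : ℕ) = sample n u := by
  rw [Fin.val_ofNat, Nat.mod_eq_of_lt ((sample_lt hn u).trans_le hK)]

end Ranking

/-! ### Deterministic dynamics of Musical Chairs after a successful learning phase -/

section Dynamics

variable {ι : Type*} {K : ℕ} [NeZero K] {T0 T1 : ℕ} {active : ℕ → Finset ι} {u : ι → ℕ → ℝ}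
  {X : Fin K → ℕ → ℝ} {mean : Fin K → ℝ} {k t : ℕ}

/-- Round `t` belongs to the Musical Chairs phase of epoch `k`, nobody has entered or left since the
start of that epoch, and the learning phase was successful. -/
structure IsReady (T0 T1 : ℕ) (active : ℕ → Finset ι) (u : ι → ℕ → ℝ) (X : Fin K → ℕ → ℝ)
    (mean : Fin K → ℝ) (k t : ℕ) : Prop where
  start_le : k * T1 + T0 ≤ t
  lt_end : t < (k + 1) * T1
  const : ∀ s, k * T1 ≤ s → s ≤ t → active s = active (k * T1)
  card_le : (active (k * T1)).card ≤ K
  estimate : ∀ i ∈ active (k * T1), playerEstimate T0 T1 active u K k i = (active (k * T1)).card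
  rank : ∀ i ∈ active (k * T1), ∀ j : Fin K, (j : ℕ) < (active (k * T1)).card →
    ranking (empMean T0 T1 active u X k i) j = ranking mean j

namespace IsReady

theorem div_eq (h : IsReady T0 T1 active u X mean k t) : t / T1 = k :=
  Nat.div_eq_of_lt_le (by have := h.start_le; omega) h.lt_end

theorem mod_eq (h : IsReady T0 T1 active u X mean k t) : t % T1 = t - k * T1 := by
  have h1 := Nat.div_add_mod t T1
  rw [h.div_eq, mul_comm] at h1
  omega

theorem active_eq (h : IsReady T0 T1 active u X mean k t) : active t = active (k * T1) :=
  h.const t (by have := h.start_le; omega) le_rfl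

theorem of_succ (h : IsReady T0 T1 active u X mean k (t + 1)) (ht : k * T1 + T0 ≤ t) :
    IsReady T0 T1 active u X mean k t where
  start_le := ht
  lt_end := (Nat.lt_succ_self t).trans h.lt_end
  const s h1 h2 := h.const s h1 (h2.trans (Nat.le_succ t))
  card_le := h.card_le
  estimate := h.estimate
  rank := h.rank

theorem runsMC (h : IsReady T0 T1 active u X mean k t) {i : ι} (hi : i ∈ active (k * T1)) :
    RunsMC T1 active i t := by
  intro s h1 h2
  rw [h.div_eq] at h1
  rwa [h.const s h1 h2]

/-- All empirical quantities drop out: every unfixed player draws from the same list of best arms,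
so two of them collide exactly when they draw the same index. -/
theorem choice_eq (h : IsReady T0 T1 active u X mean k t) {i : ι} (hi : i ∈ active (k * T1))
    (fixed : ι → Option (Fin K)) :
    choice T0 T1 active u X fixed t i =
      (fixed i).getD (ranking mean (Fin.ofNat K (sample (active (k * T1)).card (u i t)))) := by
  have hpos : 0 < (active (k * T1)).card := Finset.card_pos.2 ⟨i, hi⟩
  have h1 : ¬ (t % T1 < T0 ∨ ¬ RunsMC T1 active i t) := by
    rw [not_or, not_not, h.mod_eq]
    have := h.start_le
    exact ⟨by omega, h.runsMC hi⟩
  rw [choice, if_neg h1, h.div_eq, h.estimate i hi, h.rank i hi]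
  rw [val_ofNat_sample hpos h.card_le]
  exact sample_lt hpos _

theorem choice_mem_topArms (h : IsReady T0 T1 active u X mean k t) {i : ι}
    (hi : i ∈ active (k * T1)) {fixed : ι → Option (Fin K)}
    (hfix : ∀ c, fixed i = some c → c ∈ topArms mean (active (k * T1)).card) :
    choice T0 T1 active u X fixed t i ∈ topArms mean (active (k * T1)).card := by
  have hpos : 0 < (active (k * T1)).card := Finset.card_pos.2 ⟨i, hi⟩
  rw [h.choice_eq hi]
  cases hf : fixed i with
  | some c => exact hfix c hf
  | none =>
    rw [Option.getD_none, mem_topArms]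
    refine ⟨_, ?_, rfl⟩
    rw [val_ofNat_sample hpos h.card_le]
    exact sample_lt hpos _

theorem choice_of_fixed (h : IsReady T0 T1 active u X mean k t) {i : ι}
    (hi : i ∈ active (k * T1)) {fixed : ι → Option (Fin K)} {c : Fin K} (hc : fixed i = some c) :
    choice T0 T1 active u X fixed t i = c := by
  rw [h.choice_eq hi, hc, Option.getD_some]

open Classical in
-- Readiness at `t + 1` places that round strictly after the reset. A player already fixed may be
-- rewritten here, but with the arm that she holds.
theorem fixedArm_succ (h : IsReady T0 T1 active u X mean k (t + 1)) (ht : k * T1 + T0 ≤ t)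
    {i : ι} (hi : i ∈ active (k * T1)) :
    fixedArm T0 T1 active u X (t + 1) i =
      if Collides (active (k * T1)) (action T0 T1 active u X t) i then
        fixedArm T0 T1 active u X t i
      else some (action T0 T1 active u X t i) := by
  have h0 := h.of_succ ht
  have h1 : ¬ ((t + 1) % T1 ≤ T0) := by rw [h.mod_eq]; omega
  rw [fixedArm]
  beta_reduce
  rw [if_neg h1, h0.active_eq]
  by_cases hc : Collides (active (k * T1)) (action T0 T1 active u X t) i
  · rw [if_pos hc, if_neg (fun h => h.2 hc)]
  · rw [if_neg hc, if_pos ⟨h0.runsMC hi, hc⟩]; rfl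

/-- The reset condition is `≤ T0`, not `< T0`, so the state is still empty on entering the first
Musical Chairs round. -/
theorem fixedArm_start (h : IsReady T0 T1 active u X mean k (k * T1 + T0)) :
    fixedArm T0 T1 active u X (k * T1 + T0) = fun _ => none := by
  have hm := h.mod_eq
  cases hs : k * T1 + T0 with
  | zero => rfl
  | succ s =>
    funext i
    rw [fixedArm]
    beta_reduce
    rw [if_pos]
    rw [← hs, hm]; omega

/-- Fixed players stay fixed. -/
theorem fixedArm_succ_of_some (h : IsReady T0 T1 active u X mean k (t + 1))
    (ht : k * T1 + T0 ≤ t) {i : ι} (hi : i ∈ active (k * T1)) {c : Fin K}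
    (hc : fixedArm T0 T1 active u X t i = some c) :
    fixedArm T0 T1 active u X (t + 1) i = some c := by
  rw [h.fixedArm_succ ht hi, action, (h.of_succ ht).choice_of_fixed hi hc, hc, ite_self]

/-- Players are fixed on different arms, all of them among the best. -/
theorem fixedArm_invariant : ∀ s, IsReady T0 T1 active u X mean k (k * T1 + T0 + s) →
    (∀ i ∈ active (k * T1), ∀ c, fixedArm T0 T1 active u X (k * T1 + T0 + s) i = some c →
      c ∈ topArms mean (active (k * T1)).card) ∧
    (∀ i ∈ active (k * T1), ∀ j ∈ active (k * T1), j ≠ i → ∀ c,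
      fixedArm T0 T1 active u X (k * T1 + T0 + s) i = some c →
      fixedArm T0 T1 active u X (k * T1 + T0 + s) j ≠ some c) := by
  intro s
  induction s with
  | zero =>
    intro h
    rw [add_zero] at h ⊢
    rw [h.fixedArm_start]
    simp
  | succ s ih =>
    intro h
    rw [← add_assoc] at h ⊢
    have h0 := h.of_succ (by omega)
    obtain ⟨ih1, ih2⟩ := ih h0
    -- Being fixed on `c` after a round means having played `c` in it, and a collision in that round
    -- is possible only if she was fixed on `c` before.
    have hact : ∀ i ∈ active (k * T1), ∀ c,
        fixedArm T0 T1 active u X (k * T1 + T0 + s + 1) i = some c →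
        action T0 T1 active u X (k * T1 + T0 + s) i = c ∧
        (Collides (active (k * T1)) (action T0 T1 active u X (k * T1 + T0 + s)) i →
          fixedArm T0 T1 active u X (k * T1 + T0 + s) i = some c) := by
      intro i hi c hc
      rw [h.fixedArm_succ (by omega) hi] at hc
      split_ifs at hc with hcol
      · exact ⟨h0.choice_of_fixed hi hc, fun _ => hc⟩
      · exact ⟨Option.some.inj hc, fun h => absurd h hcol⟩
    refine ⟨fun i hi c hc => ?_, fun i hi j hj hji c hc hc' => ?_⟩
    · rw [← (hact i hi c hc).1]
      exact h0.choice_mem_topArms hi (ih1 i hi)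
    -- Two players fixed on the same arm both played it, hence collided, hence were both fixed on it
    -- one round earlier.
    · obtain ⟨hai, hi'⟩ := hact i hi c hc
      obtain ⟨haj, hj'⟩ := hact j hj c hc'
      exact ih2 i hi j hj hji c (hi' ⟨j, hj, hji, by rw [hai, haj]⟩)
        (hj' ⟨i, hi, hji.symm, by rw [hai, haj]⟩)

theorem fixedArm_mem (h : IsReady T0 T1 active u X mean k t) {i : ι} (hi : i ∈ active (k * T1))
    {c : Fin K} (hc : fixedArm T0 T1 active u X t i = some c) :
    c ∈ topArms mean (active (k * T1)).card := by
  obtain ⟨s, rfl⟩ := Nat.exists_eq_add_of_le h.start_le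
  exact (fixedArm_invariant s h).1 i hi c hc

theorem fixedArm_ne (h : IsReady T0 T1 active u X mean k t) {i j : ι} (hi : i ∈ active (k * T1))
    (hj : j ∈ active (k * T1)) (hji : j ≠ i) {c : Fin K}
    (hc : fixedArm T0 T1 active u X t i = some c) :
    fixedArm T0 T1 active u X t j ≠ some c := by
  obtain ⟨s, rfl⟩ := Nat.exists_eq_add_of_le h.start_le
  exact (fixedArm_invariant s h).2 i hi j hj hji c hc

/-- As long as a player is not fixed, one of the best arms is free. -/
theorem exists_free (h : IsReady T0 T1 active u X mean k t) {i : ι} (hi : i ∈ active (k * T1))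
    (hnone : fixedArm T0 T1 active u X t i = none) :
    ∃ j : Fin K, (j : ℕ) < (active (k * T1)).card ∧
      ∀ i' ∈ active (k * T1), fixedArm T0 T1 active u X t i' ≠ some (ranking mean j) := by
  classical
  by_contra! hcon
  -- If no best arm were free, the `N` best arms would be held by the other `N - 1` players. The
  -- default in `getD` is a dummy value.
  have hsub : topArms mean (active (k * T1)).card ⊆
      ((active (k * T1)).erase i).image
        (fun i' => (fixedArm T0 T1 active u X t i').getD (ranking mean 0)) := by
    intro c hc
    obtain ⟨j, hj, rfl⟩ := mem_topArms.1 hc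
    obtain ⟨i', hi', hfix⟩ := hcon j hj
    refine Finset.mem_image.2 ⟨i', Finset.mem_erase.2 ⟨?_, hi'⟩, by rw [hfix, Option.getD_some]⟩
    rintro rfl
    rw [hnone] at hfix
    exact absurd hfix (by simp)
  have h1 := (Finset.card_le_card hsub).trans Finset.card_image_le
  rw [card_topArms mean h.card_le, Finset.card_erase_of_mem hi] at h1
  have h2 : 0 < (active (k * T1)).card := Finset.card_pos.2 ⟨i, hi⟩
  omega

/-- A player gets fixed if she is the only one to choose some free arm. -/
theorem fixedArm_succ_ne_none (h : IsReady T0 T1 active u X mean k (t + 1))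
    (ht : k * T1 + T0 ≤ t) {i : ι} (hi : i ∈ active (k * T1))
    {j : Fin K}
    (hfree : ∀ i' ∈ active (k * T1), fixedArm T0 T1 active u X t i' ≠ some (ranking mean j))
    (hsample : sample (active (k * T1)).card (u i t) = j)
    (hothers : ∀ i' ∈ active (k * T1), i' ≠ i → sample (active (k * T1)).card (u i' t) ≠ j) :
    fixedArm T0 T1 active u X (t + 1) i ≠ none := by
  have hpos : 0 < (active (k * T1)).card := Finset.card_pos.2 ⟨i, hi⟩
  have h0 := h.of_succ ht
  cases hf : fixedArm T0 T1 active u X t i with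
  | some c => rw [h.fixedArm_succ_of_some ht hi hf]; simp
  | none =>
    have hai : action T0 T1 active u X t i = ranking mean j := by
      rw [action, h0.choice_eq hi, hf, Option.getD_none]
      congr 1
      exact Fin.ext (by rw [val_ofNat_sample hpos h.card_le, hsample])
    -- A fixed player is not on a free arm, and an unfixed one drew another index. Constraining the
    -- draws of fixed players too is wasteful, but makes the event depend on the seeds of this round
    -- alone.
    have hcol : ¬ Collides (active (k * T1)) (action T0 T1 active u X t) i := by
      rintro ⟨i', hi', hne, heq⟩
      rw [hai, action, h0.choice_eq hi'] at heq
      cases hf' : fixedArm T0 T1 active u X t i' with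
      | some c =>
        rw [hf', Option.getD_some] at heq
        exact hfree i' hi' (by rw [hf', heq])
      | none =>
        rw [hf', Option.getD_none] at heq
        have := congrArg Fin.val ((ranking mean).injective heq)
        rw [val_ofNat_sample hpos h.card_le] at this
        exact hothers i' hi' hne this
    rw [h.fixedArm_succ ht hi, if_neg hcol]
    simp

end IsReady

open Classical in
/-- The regret of round `t`. -/
noncomputable def roundRegret (T0 T1 : ℕ) (active : ℕ → Finset ι) (u : ι → ℕ → ℝ)
    (X : Fin K → ℕ → ℝ) (mean : Fin K → ℝ) (t : ℕ) : ℝ :=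
  (∑ j : Fin K, if (j : ℕ) < (active t).card then mean (ranking mean j) else 0) -
    ∑ i ∈ active t, mean (action T0 T1 active u X t i) *
      (1 - if Collides (active t) (action T0 T1 active u X t) i then 1 else 0)

theorem regret_eq_sum (T : ℕ) : regret T0 T1 active u X mean T =
    ∑ t ∈ Finset.range T, roundRegret T0 T1 active u X mean t := rfl

theorem roundRegret_le (h0 : ∀ a, 0 ≤ mean a) (h1 : ∀ a, mean a ≤ 1) :
    roundRegret T0 T1 active u X mean t ≤ K := by
  classical
  have ha : (∑ j : Fin K, if (j : ℕ) < (active t).card then mean (ranking mean j) else 0) ≤ K := by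
    calc _ ≤ ∑ j : Fin K, (1 : ℝ) := Finset.sum_le_sum fun j _ => by
            split_ifs
            · exact h1 _
            · exact zero_le_one
      _ = K := by simp
  have hb : 0 ≤ ∑ i ∈ active t, mean (action T0 T1 active u X t i) *
      (1 - if Collides (active t) (action T0 T1 active u X t) i then (1 : ℝ) else 0) := by
    refine Finset.sum_nonneg fun i _ => mul_nonneg (h0 _) ?_
    split_ifs <;> norm_num
  unfold roundRegret
  convert (sub_le_self _ hb).trans ha

/-- `N` players on distinct arms among the `N` best occupy all of them without collision, which
earns exactly the benchmark. -/
theorem IsReady.roundRegret_eq_zero (h : IsReady T0 T1 active u X mean k t)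
    (hfix : ∀ i ∈ active (k * T1), fixedArm T0 T1 active u X t i ≠ none) :
    roundRegret T0 T1 active u X mean t = 0 := by
  classical
  have hinj : Set.InjOn (action T0 T1 active u X t) (active (k * T1)) := by
    intro i hi j hj hij
    by_contra hne
    obtain ⟨c, hc⟩ := Option.ne_none_iff_exists'.1 (hfix i hi)
    obtain ⟨d, hd⟩ := Option.ne_none_iff_exists'.1 (hfix j hj)
    rw [action, action, h.choice_of_fixed hi hc, h.choice_of_fixed hj hd] at hij
    exact h.fixedArm_ne hi hj (Ne.symm hne) hc (by rw [hd, hij])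
  have himg : (active (k * T1)).image (action T0 T1 active u X t) =
      topArms mean (active (k * T1)).card := by
    refine Finset.eq_of_subset_of_card_le (fun c hc => ?_) ?_
    · obtain ⟨i, hi, rfl⟩ := Finset.mem_image.1 hc
      exact h.choice_mem_topArms hi (fun c => h.fixedArm_mem hi)
    · rw [card_topArms mean h.card_le, Finset.card_image_of_injOn hinj]
  have hcol : ∀ i ∈ active (k * T1),
      ¬ Collides (active (k * T1)) (action T0 T1 active u X t) i := by
    rintro i hi ⟨j, hj, hne, heq⟩
    exact hne (hinj hj hi heq)
  rw [roundRegret, h.active_eq, ← sum_topArms, ← himg, Finset.sum_image hinj, ← Finset.sum_sub_distrib]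
  refine Finset.sum_eq_zero fun i hi => ?_
  rw [if_neg (hcol i hi)]
  ring

end Dynamics

/-! ### Measurability, with control of the seeds that are used -/

section Measurability

instance (K : ℕ) : MeasurableSpace (Option (Fin K)) := ⊤
instance (K : ℕ) : DiscreteMeasurableSpace (Option (Fin K)) := ⟨fun _ => trivial⟩
instance (K : ℕ) : MeasurableSpace (Equiv.Perm (Fin K)) := ⊤
instance (K : ℕ) : DiscreteMeasurableSpace (Equiv.Perm (Fin K)) := ⟨fun _ => trivial⟩

variable {Ω ι : Type*} [MeasurableSpace Ω] {K : ℕ}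

theorem measurable_sample {n : Ω → ℕ} {f : Ω → ℝ} (hn : Measurable n) (hf : Measurable f) :
    Measurable fun ω => sample (n ω) (f ω) := by
  unfold sample
  have h1 : Measurable fun ω => ⌊(n ω : ℝ) * f ω⌋₊ :=
    Nat.measurable_floor.comp ((Measurable.of_discrete.comp hn).mul hf)
  have h2 : Measurable fun ω => n ω - 1 :=
    (Measurable.of_discrete (f := fun n : ℕ => n - 1)).comp hn
  exact h1.min h2

theorem measurable_ofNat_sample [NeZero K] {n : Ω → ℕ} {f : Ω → ℝ} (hn : Measurable n)
    (hf : Measurable f) : Measurable fun ω => Fin.ofNat K (sample (n ω) (f ω)) :=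
  (Measurable.of_discrete (f := fun n : ℕ => Fin.ofNat K n)).comp (measurable_sample hn hf)

theorem measurable_exploreArm [NeZero K] {f : Ω → ℝ} (hf : Measurable f) :
    Measurable fun ω => exploreArm K (f ω) :=
  measurable_ofNat_sample measurable_const hf

theorem measurable_collides {arms : Ω → ι → Fin K} (h : ∀ j, Measurable fun ω => arms ω j)
    (present : Finset ι) (i : ι) : Measurable fun ω => Collides present (arms ω) i := by
  have : (fun ω => Collides present (arms ω) i) =
      fun ω => ∃ j : present, (j : ι) ≠ i ∧ arms ω j = arms ω i := by
    funext ω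
    simp only [Collides, Subtype.exists, exists_prop]
  rw [this]
  exact Measurable.exists fun j => measurable_const.and ((h j).eq (h i))

/-- A given value of the ranking is characterised by finitely many comparisons of coordinates,
tie-breaking included. -/
theorem measurable_ranking {f : Ω → Fin K → ℝ} (hf : ∀ a, Measurable fun ω => f ω a) :
    Measurable fun ω => ranking (f ω) := by
  refine measurable_to_countable' fun σ => ?_
  have : (fun ω => ranking (f ω)) ⁻¹' {σ} = {ω | (∀ i j, i ≤ j → -f ω (σ i) ≤ -f ω (σ j)) ∧
      ∀ i j, i < j → -f ω (σ i) = -f ω (σ j) → σ i < σ j} := by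
    ext ω
    exact eq_comm.trans Tuple.eq_sort_iff
  rw [this]
  refine measurableSet_setOfPred.2 (Measurable.and ?_ ?_)
  · refine Measurable.forall fun i => Measurable.forall fun j => measurable_const.imp ?_
    exact measurableSet_setOfPred.1 (measurableSet_le (hf _).neg (hf _).neg)
  · refine Measurable.forall fun i => Measurable.forall fun j => measurable_const.imp ?_
    exact ((hf _).neg.eq (hf _).neg).imp measurable_const

variable [NeZero K] {T0 T1 : ℕ} {active : ℕ → Finset ι} {W : ι → ℕ → Ω → ℝ}
  {X : Fin K → ℕ → Ω → ℝ}

theorem mod_lt_of_mem_learningWindow (hT : T0 ≤ T1) {k t : ℕ} (ht : t ∈ learningWindow T0 T1 k) :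
    t % T1 < T0 := by
  obtain ⟨h1, h2⟩ := Finset.mem_Ico.1 ht
  obtain ⟨s, rfl⟩ := Nat.exists_eq_add_of_le h1
  have hs : s < T0 := by omega
  rwa [mul_comm, Nat.mul_add_mod, Nat.mod_eq_of_lt (by omega)]

/-- Here and below only the learning seeds are assumed measurable, so that these lemmas also apply
to the sub-σ-algebra that omits the seeds of a Musical Chairs round. -/
theorem measurable_collisionCount (hW : ∀ i t, t % T1 < T0 → Measurable (W i t)) (hT : T0 ≤ T1)
    (k : ℕ) (i : ι) :
    Measurable fun ω => collisionCount T0 T1 active (fun i t => W i t ω) K k i := by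
  simp only [collisionCount, Finset.card_filter]
  refine Finset.measurable_sum _ fun t ht => Measurable.ite ?_ measurable_const measurable_const
  exact (measurable_collides (fun j => measurable_exploreArm
    (hW j t (mod_lt_of_mem_learningWindow hT ht))) _ _).setOf

theorem measurable_playerEstimate (hW : ∀ i t, t % T1 < T0 → Measurable (W i t)) (hT : T0 ≤ T1)
    (k : ℕ) (i : ι) :
    Measurable fun ω => playerEstimate T0 T1 active (fun i t => W i t ω) K k i :=
  (Measurable.of_discrete (f := fun C : ℕ => if C = T0 then K
    else min K (round (Real.log (((T0 : ℝ) - C) / T0) /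
      Real.log (1 - 1 / (K : ℝ)) + 1)).toNat)).comp (measurable_collisionCount hW hT k i)

theorem measurable_obs (hW : ∀ i t, t % T1 < T0 → Measurable (W i t)) (hT : T0 ≤ T1)
    {k t : ℕ} (ht : t ∈ learningWindow T0 T1 k) (i : ι) (a : Fin K) :
    Measurable fun ω => exploreArm K (W i t ω) = a ∧
      ¬ Collides (active t) (fun j => exploreArm K (W j t ω)) i := by
  have h := fun j => measurable_exploreArm (K := K) (hW j t (mod_lt_of_mem_learningWindow hT ht))
  exact ((h i).eq measurable_const).and (measurable_collides h _ _).not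

theorem measurable_empMean (hW : ∀ i t, t % T1 < T0 → Measurable (W i t)) (hT : T0 ≤ T1)
    (hX : ∀ a t, Measurable (X a t)) (k : ℕ) (i : ι) (a : Fin K) :
    Measurable fun ω => empMean T0 T1 active (fun i t => W i t ω) (fun a t => X a t ω) k i a := by
  simp only [empMean, obsRounds, Finset.card_filter, Finset.sum_filter, Nat.cast_sum]
  refine Measurable.div (Finset.measurable_sum _ fun t ht => ?_)
    (Finset.measurable_sum _ fun t ht => Measurable.of_discrete.comp ?_)
  · exact Measurable.ite (measurable_obs hW hT ht i a).setOf (hX a t) measurable_const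
  · exact Measurable.ite (measurable_obs hW hT ht i a).setOf measurable_const measurable_const

theorem measurable_ranking_empMean (hW : ∀ i t, t % T1 < T0 → Measurable (W i t)) (hT : T0 ≤ T1)
    (hX : ∀ a t, Measurable (X a t)) (k : ℕ) (i : ι) :
    Measurable fun ω =>
      ranking (empMean T0 T1 active (fun i t => W i t ω) (fun a t => X a t ω) k i) :=
  measurable_ranking fun a => measurable_empMean hW hT hX k i a

theorem measurable_choice (hW : ∀ i t, t % T1 < T0 → Measurable (W i t)) (hT : T0 ≤ T1)
    (hX : ∀ a t, Measurable (X a t)) {t : ℕ} {i : ι} (hWt : Measurable (W i t))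
    {fixed : Ω → ι → Option (Fin K)} (hf : Measurable fun ω => fixed ω i) :
    Measurable fun ω => choice T0 T1 active (fun i t => W i t ω) (fun a t => X a t ω)
      (fixed ω) t i := by
  by_cases hc : t % T1 < T0 ∨ ¬ RunsMC T1 active i t
  · simp only [choice, if_pos hc]
    exact measurable_exploreArm hWt
  · simp only [choice, if_neg hc]
    exact (Measurable.of_discrete (f := fun z : (Option (Fin K) × Equiv.Perm (Fin K)) × Fin K =>
      z.1.1.getD (z.1.2 z.2))).comp ((hf.prodMk (measurable_ranking_empMean hW hT hX _ i)).prodMk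
        (measurable_ofNat_sample (measurable_playerEstimate hW hT _ i) hWt))

/-- The state before round `t` involves no seed of round `t`, unless `t` is itself a learning round;
this makes it independent of the draws in a Musical Chairs round. -/
theorem measurable_fixedArm (hW : ∀ i t, t % T1 < T0 → Measurable (W i t)) (hT : T0 ≤ T1)
    (hX : ∀ a t, Measurable (X a t)) (t : ℕ) (hWt : ∀ i, ∀ s < t, Measurable (W i s)) (i : ι) :
    Measurable fun ω => fixedArm T0 T1 active (fun i t => W i t ω) (fun a t => X a t ω) t i := by
  induction t generalizing i with
  | zero => exact measurable_const
  | succ t ih =>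
    have ih' := ih fun i s hs => hWt i s (hs.trans (Nat.lt_succ_self t))
    have hch := fun j => measurable_choice (active := active) hW hT hX (hWt j t (Nat.lt_succ_self t)) (ih' j)
    simp only [fixedArm]
    refine Measurable.ite (by simp) measurable_const (Measurable.ite ?_ ?_ (ih' i))
    · exact (measurable_const.and (measurable_collides hch _ _).not).setOf
    · exact (Measurable.of_discrete (f := fun a : Fin K => some a)).comp (hch i)

theorem measurable_action (hW : ∀ i t, Measurable (W i t)) (hT : T0 ≤ T1)
    (hX : ∀ a t, Measurable (X a t)) (t : ℕ) (i : ι) :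
    Measurable fun ω => action T0 T1 active (fun i t => W i t ω) (fun a t => X a t ω) t i :=
  measurable_choice (fun i t _ => hW i t) hT hX (hW i t)
    (measurable_fixedArm (fun i t _ => hW i t) hT hX t (fun i s _ => hW i s) i)

theorem measurable_roundRegret (hW : ∀ i t, Measurable (W i t)) (hT : T0 ≤ T1)
    (hX : ∀ a t, Measurable (X a t)) (mean : Fin K → ℝ) (t : ℕ) :
    Measurable fun ω => roundRegret T0 T1 active (fun i t => W i t ω) (fun a t => X a t ω)
      mean t := by
  unfold roundRegret
  refine measurable_const.sub (Finset.measurable_sum _ fun i _ => ?_)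
  have h := fun i => measurable_action (active := active) hW hT hX t i
  refine ((Measurable.of_discrete (f := mean)).comp (h i)).mul (measurable_const.sub ?_)
  exact Measurable.ite (measurable_collides h _ _).setOf measurable_const measurable_const

theorem measurableSet_goodEvent (hW : ∀ i t, t % T1 < T0 → Measurable (W i t)) (hT : T0 ≤ T1)
    (hX : ∀ a t, Measurable (X a t)) (mean : Fin K → ℝ) (ε : ℝ) (T : ℕ) :
    MeasurableSet (goodEvent mean ε T T0 T1 active X W) := by
  have : goodEvent mean ε T T0 T1 active X W = {ω | ∀ k, k * T1 + T0 ≤ T →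
      ∀ i : active (k * T1),
        playerEstimate T0 T1 active (fun i t => W i t ω) K k i = (active (k * T1)).card ∧
        IsCorrectRanking mean ε
          (ranking (empMean T0 T1 active (fun i t => W i t ω) (fun a t => X a t ω) k i))} := by
    ext ω
    simp [goodEvent]
  rw [this]
  refine measurableSet_setOfPred.2 (Measurable.forall fun k => measurable_const.imp
    (Measurable.forall fun i => Measurable.and ?_ ?_))
  · exact (measurable_playerEstimate hW hT k i).eq measurable_const
  · exact (Measurable.of_discrete (f := fun A => IsCorrectRanking mean ε A)).comp
      (measurable_ranking_empMean hW hT hX k i)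

end Measurability

/-! ### Uniformity of a draw -/

section Sampling

theorem measurableSet_sample_eq (n m : ℕ) : MeasurableSet {u : ℝ | sample n u = m} :=
  measurableSet_setOfPred.2 ((measurable_sample measurable_const measurable_id).eq measurable_const)

/-- The preimage of `m` lies between the half-open and the closed interval from `m / n` to `(m + 1)
/ n`, both of length `1 / n`. -/
theorem volume_sample_eq {n m : ℕ} (hm : m < n) :
    (volume.restrict (Set.Icc (0 : ℝ) 1)) {u | sample n u = m} = ENNReal.ofReal (1 / n) := by
  have hn : (0 : ℝ) < n := by exact_mod_cast (Nat.zero_le m).trans_lt hm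
  have hmn : ((m : ℝ) + 1) ≤ n := by exact_mod_cast hm
  rw [Measure.restrict_apply (measurableSet_sample_eq n m)]
  have hlen : ((m : ℝ) + 1) / n - m / n = 1 / n := by ring
  apply le_antisymm
  · rw [← hlen, ← Real.volume_Icc]
    refine measure_mono ?_
    rintro u ⟨hu, hu0, hu1⟩
    have hnu : 0 ≤ (n : ℝ) * u := mul_nonneg hn.le hu0
    have hu' : min ⌊(n : ℝ) * u⌋₊ (n - 1) = m := hu
    refine ⟨?_, ?_⟩
    · have h1 : m ≤ ⌊(n : ℝ) * u⌋₊ := by omega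
      rw [div_le_iff₀ hn, mul_comm]
      exact (Nat.le_floor_iff hnu).1 h1
    · rw [le_div_iff₀ hn, mul_comm]
      by_cases hlast : m + 1 = n
      · have : (m : ℝ) + 1 = n := by exact_mod_cast hlast
        rw [this]
        nlinarith
      · have h1 : ⌊(n : ℝ) * u⌋₊ = m := by omega
        have := Nat.lt_floor_add_one ((n : ℝ) * u)
        rw [h1] at this
        exact this.le
  · rw [← hlen, ← Real.volume_Ico]
    refine measure_mono ?_
    rintro u ⟨h1, h2⟩
    rw [div_le_iff₀ hn, mul_comm] at h1
    rw [lt_div_iff₀ hn, mul_comm] at h2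
    have hu0 : 0 ≤ u := by
      by_contra hneg
      have : (n : ℝ) * u < 0 := mul_neg_of_pos_of_neg hn (not_le.1 hneg)
      have : (0 : ℝ) ≤ m := Nat.cast_nonneg m
      linarith
    refine ⟨?_, hu0, ?_⟩
    · have : ⌊(n : ℝ) * u⌋₊ = m := (Nat.floor_eq_iff (mul_nonneg hn.le hu0)).2 ⟨h1, h2⟩
      change min ⌊(n : ℝ) * u⌋₊ (n - 1) = m
      omega
    · by_contra hcon
      have : (n : ℝ) < n * u := lt_mul_of_one_lt_right hn (not_le.1 hcon)
      linarith

end Sampling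

/-! ### σ-algebras generated by groups of rewards and seeds -/

section SigmaOf

variable {Ω ι : Type*} {K : ℕ} {X : Fin K → ℕ → Ω → ℝ} {W : ι → ℕ → Ω → ℝ}

/-- The σ-algebra generated by some of the rewards and seeds. -/
@[reducible] def sigmaOf (X : Fin K → ℕ → Ω → ℝ) (W : ι → ℕ → Ω → ℝ) (S : Set (Fin K × ℕ ⊕ ι × ℕ)) :
    MeasurableSpace Ω :=
  ⨆ z ∈ S, MeasurableSpace.comap
    (Sum.elim (fun z : Fin K × ℕ => X z.1 z.2) (fun z : ι × ℕ => W z.1 z.2) z) inferInstance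

theorem measurable_sigmaOf_reward {S : Set (Fin K × ℕ ⊕ ι × ℕ)} {a : Fin K} {t : ℕ}
    (h : Sum.inl (a, t) ∈ S) : Measurable[sigmaOf X W S] (X a t) :=
  measurable_iff_comap_le.2 (le_iSup₂_of_le (Sum.inl (a, t)) h le_rfl)

theorem measurable_sigmaOf_seed {S : Set (Fin K × ℕ ⊕ ι × ℕ)} {i : ι} {t : ℕ}
    (h : Sum.inr (i, t) ∈ S) : Measurable[sigmaOf X W S] (W i t) :=
  measurable_iff_comap_le.2 (le_iSup₂_of_le (Sum.inr (i, t)) h le_rfl)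

theorem sigmaOf_mono {S S' : Set (Fin K × ℕ ⊕ ι × ℕ)} (h : S ⊆ S') :
    sigmaOf X W S ≤ sigmaOf X W S' :=
  biSup_mono h

end SigmaOf

/-! ### Independence of groups of variables and the law of the draws -/

section Blocks

variable {Ω ι : Type*} [MeasurableSpace Ω] {K : ℕ} {P : Measure Ω}
  {ν : Fin K → Measure ℝ} {X : Fin K → ℕ → Ω → ℝ} {W : ι → ℕ → Ω → ℝ}

namespace IsModel

theorem measurable_elim (h : IsModel P ν X W) (z : Fin K × ℕ ⊕ ι × ℕ) : Measurable
    (Sum.elim (fun z : Fin K × ℕ => X z.1 z.2) (fun z : ι × ℕ => W z.1 z.2) z) := by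
  cases z with
  | inl z => exact h.measurable_reward z.1 z.2
  | inr z => exact h.measurable_seed z.1 z.2

theorem sigmaOf_le (h : IsModel P ν X W) (S : Set (Fin K × ℕ ⊕ ι × ℕ)) : sigmaOf X W S ≤ ‹MeasurableSpace Ω› :=
  iSup₂_le fun z _ => (h.measurable_elim z).comap_le

theorem indep_sigmaOf (h : IsModel P ν X W) {S S' : Set (Fin K × ℕ ⊕ ι × ℕ)} (hS : Disjoint S S') :
    Indep (sigmaOf X W S) (sigmaOf X W S') P :=
  indep_iSup_of_disjoint (fun z => (h.measurable_elim z).comap_le) h.indep hS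

theorem measureReal_inter (h : IsModel P ν X W) {S S' : Set (Fin K × ℕ ⊕ ι × ℕ)} (hS : Disjoint S S') {A B : Set Ω}
    (hA : MeasurableSet[sigmaOf X W S] A) (hB : MeasurableSet[sigmaOf X W S'] B) :
    P.real (A ∩ B) = P.real A * P.real B := by
  have := (Indep_iff _ _ _).1 (h.indep_sigmaOf hS) A B hA hB
  rw [measureReal_def, this, ENNReal.toReal_mul]; rfl

theorem measure_sample_eq (h : IsModel P ν X W) (i : ι) (t : ℕ) {n m : ℕ} (hm : m < n) :
    P {ω | sample n (W i t ω) = m} = ENNReal.ofReal (1 / n) := by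
  rw [← volume_sample_eq hm, ← h.seed_law i t,
    Measure.map_apply (h.measurable_seed i t) (measurableSet_sample_eq n m)]
  rfl

/-- The probability that player `i` is the only one to draw `m`. -/
theorem measureReal_sample_only [IsProbabilityMeasure P] (h : IsModel P ν X W)
    (A : Finset ι) {i : ι} (hi : i ∈ A)
    (t : ℕ) {n m : ℕ} (hm : m < n) :
    P.real {ω | sample n (W i t ω) = m ∧ ∀ j ∈ A, j ≠ i → sample n (W j t ω) ≠ m} =
      1 / n * (1 - 1 / n) ^ (A.card - 1) := by
  classical
  have hn : (1 : ℝ) ≤ n := by exact_mod_cast (Nat.zero_le m).trans_lt hm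
  have hn0 : (0 : ℝ) ≤ 1 / n := by positivity
  have hind : iIndepFun (fun j => W j t) P :=
    h.indep.precomp (g := fun j : ι => (Sum.inr (j, t) : Fin K × ℕ ⊕ ι × ℕ))
      fun a b hab => by simpa using hab
  let B : Set ℝ := {u | sample n u = m}
  -- Player `i` must hit `B` and the others must miss it: a product event over independent seeds.
  let s : ι → Set ℝ := fun j => if j = i then B else Bᶜ
  have hB : MeasurableSet B := measurableSet_sample_eq n m
  have hs : ∀ j ∈ A, MeasurableSet (s j) := fun j _ => by
    dsimp only [s]
    split_ifs
    exacts [hB, hB.compl]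
  have hset : {ω | sample n (W i t ω) = m ∧ ∀ j ∈ A, j ≠ i → sample n (W j t ω) ≠ m} =
      ⋂ j ∈ A, W j t ⁻¹' s j := by
    ext ω
    simp only [Set.mem_ofPred_eq, Set.mem_iInter, Set.mem_preimage, s]
    constructor
    · rintro ⟨h1, h2⟩ j hj
      split_ifs with hji
      · subst hji; exact h1
      · exact h2 j hj hji
    · intro h3
      refine ⟨?_, fun j hj hji => ?_⟩
      · have := h3 i hi
        rwa [if_pos rfl] at this
      · have := h3 j hj
        rwa [if_neg hji] at this
  have h1 : P.real (W i t ⁻¹' B) = 1 / n := by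
    rw [measureReal_def]
    exact (congrArg ENNReal.toReal (h.measure_sample_eq i t hm)).trans (ENNReal.toReal_ofReal hn0)
  have h2 : ∀ j, P.real (W j t ⁻¹' Bᶜ) = 1 - 1 / n := fun j => by
    rw [Set.preimage_compl, probReal_compl_eq_one_sub (h.measurable_seed j t hB)]
    congr 1
    rw [measureReal_def]
    exact (congrArg ENNReal.toReal (h.measure_sample_eq j t hm)).trans (ENNReal.toReal_ofReal hn0)
  rw [hset, measureReal_def, hind.measure_inter_preimage_eq_mul A hs, ENNReal.toReal_prod,
    ← Finset.mul_prod_erase A _ hi]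
  congr 1
  · dsimp only [s]
    rw [if_pos rfl]
    exact h1
  · rw [← Finset.card_erase_of_mem hi, ← Finset.prod_const]
    refine Finset.prod_congr rfl fun j hj => ?_
    simp only [s, if_neg (Finset.ne_of_mem_erase hj)]
    exact h2 j

end IsModel

/-- The base is the inverse of `1 + 1/n`, which is at most `exp (1/n)`. -/
theorem exp_neg_one_le_pow (n : ℕ) : Real.exp (-1) ≤ (1 - 1 / ((n : ℝ) + 1)) ^ n := by
  rcases Nat.eq_zero_or_pos n with rfl | hn
  · simp
  have hn' : (0 : ℝ) < n := by exact_mod_cast hn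
  have h1 : (1 - 1 / ((n : ℝ) + 1)) = (1 + 1 / (n : ℝ))⁻¹ := by field_simp; ring
  rw [h1, inv_pow, Real.exp_neg]
  apply inv_anti₀ (by positivity)
  calc (1 + 1 / (n : ℝ)) ^ n ≤ (Real.exp (1 / n)) ^ n := by
        gcongr
        rw [add_comm]
        exact Real.add_one_le_exp _
    _ = Real.exp 1 := by rw [← Real.exp_nat_mul]; congr 1; field_simp

theorem exp_neg_one_le_pow_of_le {n m : ℕ} (hn : 1 ≤ n) (hm : m ≤ n - 1) :
    Real.exp (-1) ≤ (1 - 1 / (n : ℝ)) ^ m := by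
  obtain ⟨k, rfl⟩ := Nat.exists_eq_add_of_le' hn
  rw [Nat.add_sub_cancel] at hm
  refine (exp_neg_one_le_pow k).trans ?_
  push_cast
  have h1 : 1 / ((k : ℝ) + 1) ≤ 1 := by
    rw [div_le_one (by positivity)]
    linarith [Nat.cast_nonneg (α := ℝ) k]
  exact pow_le_pow_of_le_one (by linarith) (by linarith [show 0 ≤ 1 / ((k : ℝ) + 1) by positivity]) hm

end Blocks

/-! ### Geometric decay of the probability of being unfixed -/

section Contraction

/-- Everything but the seeds of round `t`. -/
def offRound (K : ℕ) (ι : Type*) (t : ℕ) : Set (Fin K × ℕ ⊕ ι × ℕ) :=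
  {z | ∀ i, z ≠ Sum.inr (i, t)}

/-- The seeds of round `t`. -/
def seedsOf (K : ℕ) (ι : Type*) (t : ℕ) : Set (Fin K × ℕ ⊕ ι × ℕ) :=
  {z | ∃ i, z = Sum.inr (i, t)}

theorem disjoint_offRound_seedsOf {K : ℕ} {ι : Type*} (t : ℕ) : Disjoint (offRound K ι t) (seedsOf K ι t) :=
  Set.disjoint_left.2 fun _ h ⟨i, hi⟩ => h i hi

theorem one_div_mul_pow_ge {n K : ℕ} (hn : 1 ≤ n) (hK : n ≤ K) :
    Real.exp (-1) / K ≤ 1 / (n : ℝ) * (1 - 1 / n) ^ (n - 1) := by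
  have hn' : (0 : ℝ) < n := by exact_mod_cast hn
  have h1 := exp_neg_one_le_pow_of_le hn le_rfl
  have h2 : (n : ℝ) ≤ K := by exact_mod_cast hK
  calc Real.exp (-1) / K ≤ Real.exp (-1) / n := by gcongr
    _ = 1 / n * Real.exp (-1) := by ring
    _ ≤ _ := by gcongr

variable {Ω ι : Type*} [MeasurableSpace Ω] {K : ℕ} [NeZero K] {P : Measure Ω}
  [IsProbabilityMeasure P] {ν : Fin K → Measure ℝ} {X : Fin K → ℕ → Ω → ℝ} {W : ι → ℕ → Ω → ℝ}
  {T0 T1 : ℕ} {active : ℕ → Finset ι} {mean : Fin K → ℝ} {k t : ℕ} {G : Set Ω}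

/-- In each round of Musical Chairs, a player who is not fixed gets fixed with probability at least
`1 / (e K)`, conditionally on the past and on the learning phases. -/
theorem IsModel.measureReal_unfixed_succ_le (h : IsModel P ν X W) (hT : T0 ≤ T1)
    (ht : k * T1 + T0 ≤ t)
    (hG : MeasurableSet[sigmaOf X W (offRound K ι t)] G)
    (hready : ∀ ω ∈ G, IsReady T0 T1 active (fun i t => W i t ω) (fun a t => X a t ω) mean k (t + 1))
    {i : ι} (hi : i ∈ active (k * T1)) :
    P.real (G ∩ {ω | fixedArm T0 T1 active (fun i t => W i t ω) (fun a t => X a t ω) (t + 1) i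
        = none}) ≤
      (1 - Real.exp (-1) / K) * P.real (G ∩
        {ω | fixedArm T0 T1 active (fun i t => W i t ω) (fun a t => X a t ω) t i = none}) := by
  -- A point of `G` supplies the facts that do not depend on `ω`: the position of `t` in the epoch
  -- and `N ≤ K`.
  rcases G.eq_empty_or_nonempty with rfl | ⟨ω₀, hω₀⟩
  · simp
  have hr₀ := (hready ω₀ hω₀).of_succ ht
  have hpos : 0 < (active (k * T1)).card := Finset.card_pos.2 ⟨i, hi⟩
  have hmod : ¬ t % T1 < T0 := by rw [hr₀.mod_eq]; omega
  set N := (active (k * T1)).card with hN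
  set F : Ω → ι → Option (Fin K) := fun ω =>
    fixedArm T0 T1 active (fun i t => W i t ω) (fun a t => X a t ω) t with hF
  have hFm : ∀ j, Measurable[sigmaOf X W (offRound K ι t)] fun ω => F ω j := by
    let : MeasurableSpace Ω := sigmaOf X W (offRound K ι t)
    have hseed : ∀ j s, s ≠ t → Measurable (W j s) := fun j s hs =>
      measurable_sigmaOf_seed fun i' hi' => hs (congrArg Prod.snd (Sum.inr_injective hi'))
    intro j
    refine measurable_fixedArm (fun j s hs => hseed j s ?_) hT
      (fun a s => measurable_sigmaOf_reward fun i' hi' => by simp at hi') t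
      (fun j s hs => hseed j s hs.ne) j
    rintro rfl
    exact hmod hs
  let free : Fin K → Ω → Prop := fun j ω => ∀ i' : active (k * T1), F ω i' ≠ some (ranking mean j)
  -- The event is cut according to the first free best arm `j`. Each piece is determined off round
  -- `t`, hence is independent of the event `S j` that only player `i` draws `j`.
  let H : Fin K → Set Ω := fun j => G ∩ {ω | F ω i = none ∧ ((j : ℕ) < N ∧ free j ω ∧
    ∀ j', j' < j → ¬ ((j' : ℕ) < N ∧ free j' ω))}
  have hHm : ∀ j, MeasurableSet[sigmaOf X W (offRound K ι t)] (H j) := by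
    let : MeasurableSpace Ω := sigmaOf X W (offRound K ι t)
    have hfree : ∀ j, Measurable (free j) := fun j =>
      Measurable.forall fun i' => ((hFm i').eq measurable_const).not
    intro j
    refine hG.inter (Measurable.setOf (((hFm i).eq measurable_const).and
      (measurable_const.and ((hfree j).and (Measurable.forall fun j' => ?_)))))
    exact measurable_const.imp (measurable_const.and (hfree j')).not
  let S : Fin K → Set Ω := fun j =>
    {ω | sample N (W i t ω) = j ∧ ∀ i' ∈ active (k * T1), i' ≠ i → sample N (W i' t ω) ≠ j}
  have hSm : ∀ j, MeasurableSet[sigmaOf X W (seedsOf K ι t)] (S j) := by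
    let : MeasurableSpace Ω := sigmaOf X W (seedsOf K ι t)
    have hs : ∀ i', Measurable fun ω => sample N (W i' t ω) := fun i' =>
      measurable_sample measurable_const (measurable_sigmaOf_seed ⟨i', rfl⟩)
    intro j
    have : S j = {ω | sample N (W i t ω) = j ∧
        ∀ i' : active (k * T1), (i' : ι) ≠ i → sample N (W i' t ω) ≠ j} := by
      ext ω; simp [S]
    rw [this]
    exact Measurable.setOf (((hs i).eq measurable_const).and (Measurable.forall fun i' =>
      measurable_const.imp ((hs i').eq measurable_const).not))
  have hdisj : Pairwise (Function.onFun Disjoint H) := by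
    intro a b hab
    refine Set.disjoint_left.2 ?_
    rintro ω ⟨_, _, ha1, ha2, ha3⟩ ⟨_, _, hb1, hb2, hb3⟩
    rcases lt_or_gt_of_ne hab with hlt | hlt
    · exact hb3 a hlt ⟨ha1, ha2⟩
    · exact ha3 b hlt ⟨hb1, hb2⟩
  have hunion : G ∩ {ω | F ω i = none} = ⋃ j, H j := by
    ext ω
    simp only [Set.mem_iUnion]
    constructor
    · rintro ⟨hω, hnone⟩
      obtain ⟨j, hj, hfree⟩ := ((hready ω hω).of_succ ht).exists_free hi hnone
      classical
      obtain ⟨j₁, hj₁, hmin⟩ := WellFounded.has_min (wellFounded_lt (α := Fin K))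
        {j | (j : ℕ) < N ∧ free j ω} ⟨j, hj, fun i' => hfree i' i'.2⟩
      exact ⟨j₁, hω, hnone, hj₁.1, hj₁.2, fun j' hlt hj' => hmin j' hj' hlt⟩
    · rintro ⟨j, hω, hnone, -⟩
      exact ⟨hω, hnone⟩
  have hle := fun S => h.sigmaOf_le S
  -- Fixed players stay fixed, so a player unfixed at `t + 1` was unfixed at `t`, and failed to be
  -- alone on the selected free arm.
  have hsub : G ∩ {ω | fixedArm T0 T1 active (fun i t => W i t ω) (fun a t => X a t ω) (t + 1) i
      = none} ⊆ ⋃ j, H j ∩ (S j)ᶜ := by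
    rintro ω ⟨hω, hnone⟩
    have hr := hready ω hω
    have hnone' : F ω i = none := by
      by_contra hne
      obtain ⟨c, hc⟩ := Option.ne_none_iff_exists'.1 hne
      have := hr.fixedArm_succ_of_some ht hi hc
      rw [show fixedArm T0 T1 active (fun i t => W i t ω) (fun a t => X a t ω) (t + 1) i = none
        from hnone] at this
      simp at this
    have hmem : ω ∈ ⋃ j, H j := hunion ▸ ⟨hω, hnone'⟩
    obtain ⟨j, hj⟩ := Set.mem_iUnion.1 hmem
    refine Set.mem_iUnion.2 ⟨j, hj, fun hS => ?_⟩
    exact hr.fixedArm_succ_ne_none ht hi (fun i' hi' => hj.2.2.2.1 ⟨i', hi'⟩) hS.1 hS.2 hnone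
  have hterm : ∀ j, P.real (H j ∩ (S j)ᶜ) ≤ (1 - Real.exp (-1) / K) * P.real (H j) := by
    intro j
    by_cases hj : (j : ℕ) < N
    · rw [h.measureReal_inter (disjoint_offRound_seedsOf t) (hHm j) (hSm j).compl,
        probReal_compl_eq_one_sub (hle _ _ (hSm j)), mul_comm]
      have h1 : Real.exp (-1) / K ≤ P.real (S j) := by
        rw [h.measureReal_sample_only _ hi t hj]
        exact one_div_mul_pow_ge hpos hr₀.card_le
      gcongr
    · have : H j = ∅ := Set.eq_empty_of_forall_notMem fun ω hω => hj hω.2.2.1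
      simp [this]
  calc _ ≤ P.real (⋃ j, H j ∩ (S j)ᶜ) := measureReal_mono hsub
    _ ≤ ∑ j, P.real (H j ∩ (S j)ᶜ) := measureReal_iUnion_fintype_le _
    _ ≤ ∑ j, (1 - Real.exp (-1) / K) * P.real (H j) := Finset.sum_le_sum fun j _ => hterm j
    _ = _ := by
      rw [← Finset.mul_sum, hunion, measureReal_iUnion_fintype hdisj fun j => hle _ _ (hHm j)]

/-- The probability of not being fixed decays geometrically. -/
theorem IsModel.measureReal_unfixed_le (h : IsModel P ν X W) (hT : T0 ≤ T1)
    (hG : ∀ t, T0 ≤ t % T1 → MeasurableSet[sigmaOf X W (offRound K ι t)] G) {i : ι}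
    (hi : i ∈ active (k * T1)) : ∀ s : ℕ,
    (∀ ω ∈ G, IsReady T0 T1 active (fun i t => W i t ω) (fun a t => X a t ω) mean k
      (k * T1 + T0 + s)) →
    P.real (G ∩ {ω | fixedArm T0 T1 active (fun i t => W i t ω) (fun a t => X a t ω)
        (k * T1 + T0 + s) i = none}) ≤ (1 - Real.exp (-1) / K) ^ s * P.real G := by
  intro s
  induction s with
  | zero =>
    intro _
    rw [pow_zero, one_mul]
    exact measureReal_mono Set.inter_subset_left
  | succ s ih =>
    intro hready
    have hK : (1 : ℝ) ≤ K := by exact_mod_cast NeZero.one_le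
    have hq : 0 ≤ 1 - Real.exp (-1) / K := by
      have h1 : Real.exp (-1) / K ≤ Real.exp (-1) := div_le_self (Real.exp_pos _).le hK
      have h2 : Real.exp (-1) ≤ 1 := Real.exp_le_one_iff.2 (by norm_num)
      linarith
    rcases G.eq_empty_or_nonempty with rfl | ⟨ω₀, hω₀⟩
    · simp
    have hts : k * T1 + T0 ≤ k * T1 + T0 + s := Nat.le_add_right _ _
    have hr₀ := IsReady.of_succ (t := k * T1 + T0 + s) (hready ω₀ hω₀) hts
    have hmod : T0 ≤ (k * T1 + T0 + s) % T1 := by rw [hr₀.mod_eq]; omega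
    rw [pow_succ', mul_assoc]
    refine (h.measureReal_unfixed_succ_le hT hts (hG _ hmod) hready hi).trans ?_
    exact mul_le_mul_of_nonneg_left (ih fun ω hω => (hready ω hω).of_succ hts) hq

end Contraction

/-! ### Exponential moments and a Chernoff bound over separate rounds -/

section Concentration

variable {Ω ι : Type*} [MeasurableSpace Ω] {K : ℕ} {P : Measure Ω}
  {ν : Fin K → Measure ℝ} {X : Fin K → ℕ → Ω → ℝ} {W : ι → ℕ → Ω → ℝ}

/-- The rewards and seeds of round `t`. -/
def roundBlock (K : ℕ) (ι : Type*) (t : ℕ) : Set (Fin K × ℕ ⊕ ι × ℕ) :=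
  {z | Sum.elim Prod.snd Prod.snd z = t}

theorem IsModel.reward_mem_Icc [IsProbabilityMeasure P] (h : IsModel P ν X W) (a : Fin K) (t : ℕ) :
    ∀ᵐ ω ∂P, X a t ω ∈ Set.Icc (0 : ℝ) 1 := by
  have h1 := h.reward_range a
  rw [← h.reward_law a t, Measure.map_apply (h.measurable_reward a t) measurableSet_Icc] at h1
  exact (mem_ae_iff_prob_eq_one (h.measurable_reward a t measurableSet_Icc)).2 h1

theorem IsModel.integral_reward (h : IsModel P ν X W) (a : Fin K) (t : ℕ) :
    ∫ ω, X a t ω ∂P = ∫ y, y ∂(ν a) := by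
  rw [← h.reward_law a t, integral_map (h.measurable_reward a t).aemeasurable
    (f := fun y => y) measurable_id.aestronglyMeasurable]

theorem IsModel.mean_mem_Icc [IsProbabilityMeasure P] (h : IsModel P ν X W) (a : Fin K) :
    ∫ y, y ∂(ν a) ∈ Set.Icc (0 : ℝ) 1 := by
  have h1 := h.reward_mem_Icc a 0
  have hint := Integrable.of_mem_Icc 0 1 (h.measurable_reward a 0).aemeasurable h1
  rw [← h.integral_reward a 0]
  refine ⟨integral_nonneg_of_ae (h1.mono fun ω hω => hω.1), ?_⟩
  refine (integral_mono_ae hint (integrable_const 1) (h1.mono fun ω hω => hω.2)).trans ?_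
  simp

/-- A function of one group of variables and a function of another are independent. -/
theorem IsModel.indepFun_of_disjoint (h : IsModel P ν X W) {S S' : Set (Fin K × ℕ ⊕ ι × ℕ)}
    (hS : Disjoint S S') {f g : Ω → ℝ} (hf : Measurable[sigmaOf X W S] f)
    (hg : Measurable[sigmaOf X W S'] g) : IndepFun f g P := by
  rw [IndepFun_iff_Indep]
  exact indep_of_indep_of_le_left (indep_of_indep_of_le_right (h.indep_sigmaOf hS)
    (measurable_iff_comap_le.1 hg)) (measurable_iff_comap_le.1 hf)

/-- Distinct rounds use disjoint groups of variables, so one round at a time can be split off by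
independence. -/
theorem IsModel.integral_prod_rounds [IsProbabilityMeasure P] (h : IsModel P ν X W)
    {Z : ℕ → Ω → ℝ} (S : Finset ℕ)
    (hZ : ∀ t ∈ S, Measurable[sigmaOf X W (roundBlock K ι t)] (Z t)) :
    ∫ ω, ∏ t ∈ S, Z t ω ∂P = ∏ t ∈ S, ∫ ω, Z t ω ∂P := by
  induction S using Finset.induction_on with
  | empty => simp
  | insert t S htS ih =>
    simp only [Finset.prod_insert htS]
    rw [← ih fun s hs => hZ s (Finset.mem_insert_of_mem hs)]
    have h1 : Measurable[sigmaOf X W {z | Sum.elim Prod.snd Prod.snd z ∈ S}]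
        fun ω => ∏ s ∈ S, Z s ω := by
      refine Finset.measurable_prod _ fun s hs => ?_
      refine (hZ s (Finset.mem_insert_of_mem hs)).mono (sigmaOf_mono ?_) le_rfl
      intro z hz
      change Sum.elim Prod.snd Prod.snd z ∈ S
      rwa [show Sum.elim Prod.snd Prod.snd z = s from hz]
    have h0 := hZ t (Finset.mem_insert_self t S)
    refine (h.indepFun_of_disjoint ?_ h0 h1).integral_fun_mul_eq_mul_integral
      (h0.mono (h.sigmaOf_le _) le_rfl).aestronglyMeasurable
      (h1.mono (h.sigmaOf_le _) le_rfl).aestronglyMeasurable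
    refine Set.disjoint_left.2 fun z hz hz' => htS ?_
    rwa [← show Sum.elim Prod.snd Prod.snd z = t from hz]

/-- Chernoff bound for a sum of functions of different rounds. -/
theorem IsModel.measureReal_sum_nonneg_le [IsProbabilityMeasure P] (h : IsModel P ν X W)
    {Z : ℕ → Ω → ℝ} {S : Finset ℕ} {B c : ℝ}
    (hZ : ∀ t ∈ S, Measurable[sigmaOf X W (roundBlock K ι t)] (Z t))
    (hB : ∀ t ∈ S, ∀ᵐ ω ∂P, Z t ω ≤ B) (hc : ∀ t ∈ S, ∫ ω, Real.exp (Z t ω) ∂P ≤ c) :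
    P.real {ω | 0 ≤ ∑ t ∈ S, Z t ω} ≤ c ^ S.card := by
  have hm : Measurable fun ω => Real.exp (∑ t ∈ S, Z t ω) :=
    Real.measurable_exp.comp (Finset.measurable_sum _ fun t ht =>
      (hZ t ht).mono (h.sigmaOf_le _) le_rfl)
  have hint : Integrable (fun ω => Real.exp (∑ t ∈ S, Z t ω)) P := by
    refine Integrable.of_bound hm.aestronglyMeasurable (Real.exp (∑ t ∈ S, B)) ?_
    have : ∀ᵐ ω ∂P, ∀ t ∈ S, Z t ω ≤ B := (ae_ball_iff S.countable_toSet).2 hB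
    filter_upwards [this] with ω hω
    rw [Real.norm_eq_abs, abs_of_pos (Real.exp_pos _)]
    exact Real.exp_le_exp.2 (Finset.sum_le_sum hω)
  -- Markov's inequality for the exponential of the sum at threshold `1`; any tilt is already
  -- contained in `Z`.
  have hmarkov := mul_meas_ge_le_integral_of_nonneg
    (Filter.Eventually.of_forall fun ω => (Real.exp_pos (∑ t ∈ S, Z t ω)).le) hint 1
  simp only [Real.one_le_exp_iff, one_mul] at hmarkov
  refine hmarkov.trans ?_
  simp only [Real.exp_sum]
  rw [h.integral_prod_rounds (Z := fun t ω => Real.exp (Z t ω)) S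
    fun t ht => Real.measurable_exp.comp (hZ t ht)]
  exact (Finset.prod_le_prod (fun t _ => integral_nonneg fun ω => (Real.exp_pos _).le) hc).trans_eq
    (by rw [Finset.prod_const])

/-- Hoeffding's lemma for variables in `[0, 1]`. -/
theorem integral_exp_le_of_mem_Icc [IsProbabilityMeasure P] {Y : Ω → ℝ} (hY : Measurable Y)
    (hb : ∀ᵐ ω ∂P, Y ω ∈ Set.Icc (0 : ℝ) 1) (s : ℝ) :
    ∫ ω, Real.exp (s * (Y ω - ∫ ω, Y ω ∂P)) ∂P ≤ Real.exp (s ^ 2 / 8) := by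
  have := (hasSubgaussianMGF_of_mem_Icc hY.aemeasurable hb).mgf_le s
  refine this.trans_eq ?_
  -- The variance proxy of an interval of length `1` is `1/4`.
  congr 1
  simp
  ring

end Concentration

/-! ### Deterministic accuracy criteria for the two estimates -/

section Estimates

/-- A sufficiently precise estimate of the probability of not colliding identifies the number of
players. -/
theorem round_log_div_log_eq {K N : ℕ} {y : ℝ} (hN : 1 ≤ N) (hNK : N ≤ K)
    (hy : |y - (1 - 1 / (K : ℝ)) ^ (N - 1)| < 0.1 / K) :
    0 < y ∧ min K (round (Real.log y / Real.log (1 - 1 / (K : ℝ)) + 1)).toNat = N := by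
  obtain ⟨hy1, hy2⟩ := abs_lt.1 hy
  have hK1 : 1 ≤ K := hN.trans hNK
  have hK : (0 : ℝ) < K := by exact_mod_cast hK1
  have hpow := exp_neg_one_le_pow_of_le (n := K) (m := N - 1) hK1 (by omega)
  have he : (0.36 : ℝ) < Real.exp (-1) := by
    have := Real.exp_neg_one_gt_d9
    linarith
  set r : ℝ := 1 - 1 / (K : ℝ) with hr
  have hKi : 1 / (K : ℝ) ≤ 1 := by rw [div_le_one hK]; exact_mod_cast hK1
  have hKp : 0 < 1 / (K : ℝ) := by positivity
  have h01 : 0.1 / (K : ℝ) = 0.1 * (1 / K) := by ring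
  rw [h01] at hy1 hy2
  have hy0 : 0 < y := by linarith
  refine ⟨hy0, ?_⟩
  rcases hK1.eq_or_lt with rfl | hK2
  -- For `K = 1` the denominator is `log 0 = 0`, so the quotient is `0` by convention and the
  -- rounded value is `1`.
  · have hN1 : N = 1 := le_antisymm hNK hN
    subst hN1
    simp [hr]
  have hKi2 : 1 / (K : ℝ) ≤ 1 / 2 := by
    apply one_div_le_one_div_of_le (by norm_num)
    exact_mod_cast hK2
  have hr0 : 0 < r := by rw [hr]; linarith
  have hr1 : r < 1 := by rw [hr]; linarith
  have hlogr : Real.log r < 0 := Real.log_neg hr0 hr1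
  have hs0 : 0 < Real.sqrt r := Real.sqrt_pos.2 hr0
  have hs1 : Real.sqrt r ≤ 1 - 1 / (2 * K) := by
    apply Real.sqrt_le_iff.2
    have : 1 / (2 * (K : ℝ)) = 1 / 2 * (1 / K) := by field_simp
    rw [this]
    constructor
    · linarith
    · rw [hr]; nlinarith
  -- Rounding changes at half-integer exponents of `r`. Passing from `r^(N-1)` to the next one loses
  -- at least `0.36 / (2K) = 0.18 / K`, more than the tolerance `0.1 / K`.
  have hgap : r ^ (N - 1) * Real.sqrt r + 0.1 * (1 / K) < r ^ (N - 1) := by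
    have h1 : 1 / (2 * (K : ℝ)) = 1 / 2 * (1 / K) := by field_simp
    rw [h1] at hs1
    have h2 : 0.36 * (1 / 2 * (1 / (K : ℝ))) ≤ r ^ (N - 1) * (1 - Real.sqrt r) := by
      apply mul_le_mul <;> linarith
    linarith
  have hm : 0 < r ^ (N - 1) := pow_pos hr0 _
  have hcast : ((N - 1 : ℕ) : ℝ) = (N : ℝ) - 1 := by rw [Nat.cast_sub hN, Nat.cast_one]
  have hlow : ((N : ℝ) - 1) * Real.log r + Real.log r / 2 < Real.log y := by
    rw [← hcast, ← Real.log_pow, ← Real.log_sqrt hr0.le, ← Real.log_mul hm.ne' hs0.ne']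
    exact Real.log_lt_log (mul_pos hm hs0) (by linarith)
  -- Multiplying `y` by `√r` avoids the exponent `N - 3/2`, which is negative for `N = 1`.
  have hup : Real.log y + Real.log r / 2 ≤ ((N : ℝ) - 1) * Real.log r := by
    rw [← hcast, ← Real.log_pow, ← Real.log_sqrt hr0.le, ← Real.log_mul hy0.ne' hs0.ne']
    refine Real.log_le_log (mul_pos hy0 hs0) ?_
    have hsle : Real.sqrt r ≤ 1 := by linarith [show 0 < 1 / (2 * (K : ℝ)) by positivity]
    have h1 : y * Real.sqrt r ≤ (r ^ (N - 1) + 0.1 * (1 / K)) * Real.sqrt r := by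
      gcongr
      linarith
    have h2 : 0.1 * (1 / (K : ℝ)) * Real.sqrt r ≤ 0.1 * (1 / K) :=
      mul_le_of_le_one_right (by positivity) hsle
    linarith
  have hround : round (Real.log y / Real.log r + 1) = (N : ℤ) := by
    rw [round_eq, Int.floor_eq_iff]
    push_cast
    have h1 : (N : ℝ) - 3 / 2 ≤ Real.log y / Real.log r := by
      rw [le_div_iff_of_neg hlogr]; linarith
    have h2 : Real.log y / Real.log r < (N : ℝ) - 1 / 2 := by
      rw [div_lt_iff_of_neg hlogr]; linarith
    constructor <;> linarith
  rw [hround, Int.toNat_natCast, min_eq_right hNK]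

theorem isCorrectRanking_of_bounds {K : ℕ} {mean f : Fin K → ℝ} {ε : ℝ}
    (h : ∀ a, f a < mean a + ε / 2 ∧ mean a - ε / 2 < f a) :
    IsCorrectRanking mean ε (ranking f) := by
  intro a b hab
  by_contra hlt
  have := antitone_ranking f (not_lt.1 hlt)
  simp only [Equiv.apply_symm_apply] at this
  have h1 := (h a).2
  have h2 := (h b).1
  linarith

variable {ι : Type*} {K : ℕ} [NeZero K] {T0 T1 : ℕ} {active : ℕ → Finset ι} {u : ι → ℕ → ℝ}
  {X : Fin K → ℕ → ℝ} {k : ℕ} {A : Finset ι} {i : ι}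

theorem card_learningWindow : (learningWindow T0 T1 k).card = T0 := by
  simp [learningWindow]

open Classical in
-- The two sums say that the frequency of collision-free rounds is within `0.1 / K` of its mean.
-- They are written in the form to which the Chernoff bound applies.
theorem playerEstimate_eq (hT0 : 0 < T0) (hi : i ∈ A) (hA : A.card ≤ K)
    (hact : ∀ t ∈ learningWindow T0 T1 k, active t = A)
    (h1 : ∑ t ∈ learningWindow T0 T1 k,
      ((if Collides A (fun j => exploreArm K (u j t)) i then (0 : ℝ) else 1) -
        ((1 - 1 / (K : ℝ)) ^ (A.card - 1) + 0.1 / K)) < 0)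
    (h2 : ∑ t ∈ learningWindow T0 T1 k,
      (((1 - 1 / (K : ℝ)) ^ (A.card - 1) - 0.1 / K) -
        (if Collides A (fun j => exploreArm K (u j t)) i then (0 : ℝ) else 1)) < 0) :
    playerEstimate T0 T1 active u K k i = A.card := by
  have hT : (0 : ℝ) < T0 := by exact_mod_cast hT0
  have hsum : ∑ t ∈ learningWindow T0 T1 k,
      (if Collides A (fun j => exploreArm K (u j t)) i then (0 : ℝ) else 1) =
      T0 - collisionCount T0 T1 active u K k i := by
    have : (collisionCount T0 T1 active u K k i : ℝ) = ∑ t ∈ learningWindow T0 T1 k,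
        (if Collides A (fun j => exploreArm K (u j t)) i then (1 : ℝ) else 0) := by
      rw [collisionCount, Finset.card_filter, Nat.cast_sum]
      refine Finset.sum_congr rfl fun t ht => ?_
      rw [hact t ht]
      split_ifs <;> simp
    rw [this, eq_sub_iff_add_eq, ← Finset.sum_add_distrib]
    rw [show (T0 : ℝ) = ((learningWindow T0 T1 k).card : ℝ) by rw [card_learningWindow],
      Finset.cast_card]
    refine Finset.sum_congr rfl fun t _ => ?_
    split_ifs <;> simp
  rw [Finset.sum_sub_distrib, hsum, Finset.sum_const, card_learningWindow, nsmul_eq_mul] at h1 h2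
  set C := collisionCount T0 T1 active u K k i with hC
  have hy : |((T0 : ℝ) - C) / T0 - (1 - 1 / (K : ℝ)) ^ (A.card - 1)| < 0.1 / K := by
    rw [abs_lt]
    constructor
    · rw [neg_lt_sub_iff_lt_add, ← sub_lt_iff_lt_add', lt_div_iff₀ hT]; linarith
    · rw [sub_lt_iff_lt_add, div_lt_iff₀ hT]; linarith
  obtain ⟨hpos, hround⟩ := round_log_div_log_eq (Finset.card_pos.2 ⟨i, hi⟩) hA hy
  rw [playerEstimate, ← hC, if_neg, hround]
  intro hCT
  rw [hCT] at hpos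
  simp at hpos

open Classical in
-- Strict negativity already forces an observation, since an empty sum is `0`. No separate lower
-- bound on the number of observations is needed.
theorem empMean_bounds {ε m : ℝ} {a : Fin K} (hact : ∀ t ∈ learningWindow T0 T1 k, active t = A)
    (h1 : ∑ t ∈ learningWindow T0 T1 k,
      (if exploreArm K (u i t) = a ∧ ¬ Collides A (fun j => exploreArm K (u j t)) i then
        (X a t - m) - ε / 2 else 0) < 0)
    (h2 : ∑ t ∈ learningWindow T0 T1 k,
      (if exploreArm K (u i t) = a ∧ ¬ Collides A (fun j => exploreArm K (u j t)) i then
        -(X a t - m) - ε / 2 else 0) < 0) :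
    empMean T0 T1 active u X k i a < m + ε / 2 ∧ m - ε / 2 < empMean T0 T1 active u X k i a := by
  have hobs : obsRounds T0 T1 active u k i a = (learningWindow T0 T1 k).filter fun t =>
      exploreArm K (u i t) = a ∧ ¬ Collides A (fun j => exploreArm K (u j t)) i := by
    refine Finset.filter_congr fun t ht => ?_
    rw [hact t ht]
  rw [← Finset.sum_filter, ← hobs] at h1 h2
  have hpos : 0 < (obsRounds T0 T1 active u k i a).card := by
    rw [Finset.card_pos]
    by_contra hne
    rw [Finset.not_nonempty_iff_eq_empty.1 hne] at h1
    simp at h1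
  have hpos' : (0 : ℝ) < (obsRounds T0 T1 active u k i a).card := by exact_mod_cast hpos
  simp only [Finset.sum_sub_distrib, Finset.sum_neg_distrib, Finset.sum_const, nsmul_eq_mul]
    at h1 h2
  rw [empMean, div_lt_iff₀ hpos', lt_div_iff₀ hpos']
  constructor <;> linarith

end Estimates

/-! ### Probabilistic bounds for exploration rounds -/

section LearningPhase

variable {Ω ι : Type*} {K : ℕ} [NeZero K] {X : Fin K → ℕ → Ω → ℝ} {W : ι → ℕ → Ω → ℝ}
  {A : Finset ι} {i : ι}

/-- Player `i` does not collide in a round of exploration. -/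
def noCollision (K : ℕ) [NeZero K] (W : ι → ℕ → Ω → ℝ) (A : Finset ι) (i : ι) (t : ℕ) : Set Ω :=
  {ω | ¬ Collides A (fun j => exploreArm K (W j t ω)) i}

/-- Player `i` observes arm `a` in a round of exploration. -/
def observes (W : ι → ℕ → Ω → ℝ) (A : Finset ι) (i : ι) (a : Fin K) (t : ℕ) : Set Ω :=
  {ω | exploreArm K (W i t ω) = a ∧ ¬ Collides A (fun j => exploreArm K (W j t ω)) i}

theorem measurableSet_observes {S : Set (Fin K × ℕ ⊕ ι × ℕ)} {t : ℕ}
    (hS : ∀ j, Sum.inr (j, t) ∈ S) (a : Fin K) :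
    MeasurableSet[sigmaOf X W S] (observes W A i a t) := by
  let : MeasurableSpace Ω := sigmaOf X W S
  have hm := fun j => measurable_exploreArm (K := K) (measurable_sigmaOf_seed (X := X) (hS j))
  exact (((hm i).eq measurable_const).and (measurable_collides hm _ _).not).setOf

theorem measurableSet_noCollision {S : Set (Fin K × ℕ ⊕ ι × ℕ)} {t : ℕ}
    (hS : ∀ j, Sum.inr (j, t) ∈ S) :
    MeasurableSet[sigmaOf X W S] (noCollision K W A i t) := by
  let : MeasurableSpace Ω := sigmaOf X W S
  have hm := fun j => measurable_exploreArm (K := K) (measurable_sigmaOf_seed (X := X) (hS j))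
  exact (measurable_collides hm _ _).not.setOf

variable [MeasurableSpace Ω] {P : Measure Ω} [IsProbabilityMeasure P] {ν : Fin K → Measure ℝ}

theorem exploreArm_eq_iff (v : ℝ) (a : Fin K) : exploreArm K v = a ↔ sample K v = a := by
  rw [Fin.ext_iff, exploreArm, val_ofNat_sample (NeZero.pos K) le_rfl]

theorem IsModel.measureReal_observes (h : IsModel P ν X W) (hi : i ∈ A) (a : Fin K) (t : ℕ) :
    P.real (observes W A i a t) = 1 / K * (1 - 1 / K) ^ (A.card - 1) := by
  rw [← h.measureReal_sample_only A hi t a.2]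
  congr 1
  ext ω
  simp only [observes, Set.mem_ofPred_eq, exploreArm_eq_iff]
  refine and_congr_right fun h1 => ?_
  have h2 : exploreArm K (W i t ω) = a := (exploreArm_eq_iff _ _).2 h1
  simp only [Collides, not_exists, not_and, h2, exploreArm_eq_iff]

theorem IsModel.measureReal_noCollision (h : IsModel P ν X W) (hi : i ∈ A) (t : ℕ) :
    P.real (noCollision K W A i t) = (1 - 1 / K) ^ (A.card - 1) := by
  have hunion : noCollision K W A i t = ⋃ a : Fin K, observes W A i a t := by
    ext ω
    simp [noCollision, observes]
  have hdisj : Pairwise (Function.onFun Disjoint fun a : Fin K => observes W A i a t) :=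
    fun a b hab => Set.disjoint_left.2 fun ω ha hb => hab (ha.1.symm.trans hb.1)
  rw [hunion, measureReal_iUnion_fintype hdisj fun a => h.sigmaOf_le _ _
    (measurableSet_observes (S := Set.univ) (fun _ => trivial) a)]
  simp only [h.measureReal_observes hi, Finset.sum_const, Finset.card_univ, Fintype.card_fin,
    nsmul_eq_mul]
  have : (K : ℝ) ≠ 0 := NeZero.ne _
  field_simp

/-- Deviations of the number of collisions. -/
theorem IsModel.measureReal_noCollision_sum_le (h : IsModel P ν X W) (hi : i ∈ A) (S : Finset ℕ)
    {η s : ℝ} (hη : 0 ≤ η) (hs : s ^ 2 = 1) :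
    P.real {ω | 0 ≤ ∑ t ∈ S, (s * ((noCollision K W A i t).indicator 1 ω -
      (1 - 1 / K) ^ (A.card - 1)) - η)} ≤ Real.exp (-2 * η ^ 2) ^ S.card := by
  rcases hη.eq_or_lt with rfl | hη
  · simp
  set p : ℝ := (1 - 1 / (K : ℝ)) ^ (A.card - 1) with hp
  -- The tilt `4η` minimises the Hoeffding exponent `λ²/8 - λη`, with minimum `-2η²`.
  have hset : {ω | 0 ≤ ∑ t ∈ S, (s * ((noCollision K W A i t).indicator 1 ω - p) - η)} =
      {ω | 0 ≤ ∑ t ∈ S, 4 * η * (s * ((noCollision K W A i t).indicator 1 ω - p) - η)} := by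
    ext ω
    simp only [Set.mem_ofPred_eq, ← Finset.mul_sum]
    exact (mul_nonneg_iff_of_pos_left (by positivity)).symm
  rw [hset]
  have hmem : ∀ t, t ∈ S → ∀ j : ι, (Sum.inr (j, t) : Fin K × ℕ ⊕ ι × ℕ) ∈ roundBlock K ι t :=
    fun t _ j => rfl
  have hind : ∀ t ω, (noCollision K W A i t).indicator (1 : Ω → ℝ) ω ∈ Set.Icc (0 : ℝ) 1 := by
    intro t ω
    by_cases hω : ω ∈ noCollision K W A i t <;> simp [hω]
  have hsabs : |s| = 1 := by
    rw [← Real.sqrt_sq_eq_abs, hs, Real.sqrt_one]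
  refine h.measureReal_sum_nonneg_le (B := 4 * η * (1 + |p|)) (fun t ht => ?_) (fun t ht => ?_)
    (fun t ht => ?_)
  · exact ((((measurable_const (a := (1 : ℝ))).indicator (measurableSet_noCollision (hmem t ht))).sub_const _).const_mul _
      |>.sub_const _).const_mul _
  · refine Filter.Eventually.of_forall fun ω => ?_
    have h1 : s * ((noCollision K W A i t).indicator 1 ω - p) ≤ 1 + |p| := by
      refine (le_abs_self _).trans ?_
      rw [abs_mul, hsabs, one_mul]
      refine (abs_sub _ _).trans ?_
      have := hind t ω
      rw [abs_of_nonneg this.1]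
      linarith [this.2]
    gcongr
    linarith
  · have hms := h.sigmaOf_le _ _ (measurableSet_noCollision (A := A) (i := i) (hmem t ht))
    have hmean : ∫ ω, (noCollision K W A i t).indicator (1 : Ω → ℝ) ω ∂P = p := by
      rw [integral_indicator_one hms, h.measureReal_noCollision hi]
    have hoeff := integral_exp_le_of_mem_Icc (P := P) (measurable_one.indicator hms)
      (Filter.Eventually.of_forall (hind t)) (4 * η * s)
    rw [hmean] at hoeff
    calc ∫ ω, Real.exp (4 * η * (s * ((noCollision K W A i t).indicator 1 ω - p) - η)) ∂P
        = ∫ ω, Real.exp (4 * η * s * ((noCollision K W A i t).indicator 1 ω - p)) *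
            Real.exp (-(4 * η ^ 2)) ∂P := by
          congr 1 with ω
          rw [← Real.exp_add]
          congr 1
          ring
      _ ≤ Real.exp ((4 * η * s) ^ 2 / 8) * Real.exp (-(4 * η ^ 2)) := by
          rw [integral_mul_const]
          gcongr
      _ = Real.exp (-2 * η ^ 2) := by
          rw [← Real.exp_add, mul_pow, hs]
          congr 1
          ring

/-- The exponential moment of one observation. -/
theorem IsModel.integral_exp_observes_le (h : IsModel P ν X W) {mean : Fin K → ℝ}
    (hmean : ∀ k, mean k = ∫ y, y ∂(ν k)) (hi : i ∈ A) (hA : A.card ≤ K) (a : Fin K)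
    {ε s : ℝ} (hε : 0 < ε) (hε1 : ε ≤ 1) (hs : s ^ 2 = 1) {t : ℕ} {g : Ω → ℝ}
    (hg : g = fun ω => s * (X a t ω - mean a) - ε / 2)
    (hgm : Measurable[sigmaOf X W {Sum.inl (a, t)}] g)
    (hgb : ∀ᵐ ω ∂P, g ω ≤ 1 + |mean a|) :
    ∫ ω, Real.exp (2 * ε * (observes W A i a t).indicator g ω) ∂P ≤
      Real.exp (-(Real.exp (-1) / K * (1 / 3 * ε ^ 2))) := by
  have hO : MeasurableSet[sigmaOf X W (seedsOf K ι t)] (observes W A i a t) :=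
    measurableSet_observes (S := seedsOf K ι t) (fun j => ⟨j, rfl⟩) a
  -- Whether the arm is observed depends on seeds only and `g` on the reward only, so the two are
  -- independent.
  have hdisj : Disjoint (seedsOf K ι t) ({Sum.inl (a, t)} : Set (Fin K × ℕ ⊕ ι × ℕ)) := by
    refine Set.disjoint_left.2 ?_
    rintro _ ⟨j, rfl⟩ h2
    simp at h2
  set p := P.real (observes W A i a t) with hp
  have hOm := h.sigmaOf_le _ _ (hO)
  have hgm' := (hgm).mono (h.sigmaOf_le _) le_rfl
  have hexpm : Measurable[sigmaOf X W {Sum.inl (a, t)}] fun ω => Real.exp (2 * ε * g ω) :=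
    Real.measurable_exp.comp ((hgm).const_mul _)
  have hexpm' := hexpm.mono (h.sigmaOf_le _) le_rfl
  have hexpi : Integrable (fun ω => Real.exp (2 * ε * g ω)) P := by
    refine Integrable.of_bound hexpm'.aestronglyMeasurable (Real.exp (2 * ε * (1 + |mean a|))) ?_
    filter_upwards [hgb] with ω hω
    rw [Real.norm_eq_abs, abs_of_pos (Real.exp_pos _)]
    gcongr
  have h1m : Measurable[sigmaOf X W (seedsOf K ι t)]
      ((observes W A i a t).indicator (1 : Ω → ℝ)) :=
    (measurable_const (a := (1 : ℝ))).indicator (hO)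
  have hprod : ∫ ω, (observes W A i a t).indicator (1 : Ω → ℝ) ω * Real.exp (2 * ε * g ω) ∂P =
      p * ∫ ω, Real.exp (2 * ε * g ω) ∂P := by
    rw [(h.indepFun_of_disjoint (hdisj) h1m hexpm).integral_fun_mul_eq_mul_integral
      (h1m.mono (h.sigmaOf_le _) le_rfl).aestronglyMeasurable hexpm'.aestronglyMeasurable,
      integral_indicator_one hOm]
  -- With tilt `2ε`, Hoeffding contributes `ε²/2` and the drift `-ε²`. The passage from `exp
  -- (-ε²/2)` to `1 - ε²/3` uses `ε ≤ 1`.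
  have hexp : ∫ ω, Real.exp (2 * ε * g ω) ∂P ≤ 1 - 1 / 3 * ε ^ 2 := by
    have hoeff := integral_exp_le_of_mem_Icc (P := P) (h.measurable_reward a t)
      (h.reward_mem_Icc a t) (2 * ε * s)
    rw [h.integral_reward, ← hmean] at hoeff
    calc ∫ ω, Real.exp (2 * ε * g ω) ∂P
        = ∫ ω, Real.exp (2 * ε * s * (X a t ω - mean a)) * Real.exp (-ε ^ 2) ∂P := by
          congr 1 with ω
          rw [← Real.exp_add]
          congr 1
          simp only [hg]
          ring
      _ ≤ Real.exp ((2 * ε * s) ^ 2 / 8) * Real.exp (-ε ^ 2) := by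
          rw [integral_mul_const]
          gcongr
      _ = (Real.exp (ε ^ 2 / 2))⁻¹ := by
          rw [← Real.exp_add, ← Real.exp_neg, mul_pow, hs]
          congr 1
          ring
      _ ≤ (1 + ε ^ 2 / 2)⁻¹ := by
          apply inv_anti₀ (by positivity)
          rw [add_comm]
          exact Real.add_one_le_exp _
      _ ≤ 1 - 1 / 3 * ε ^ 2 := by
          have h2 : ε ^ 2 ≤ 1 := pow_le_one₀ hε.le hε1
          rw [inv_le_iff_one_le_mul₀ (by positivity)]
          nlinarith [sq_nonneg ε]
  have hpge : Real.exp (-1) / K ≤ p := by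
    rw [hp, h.measureReal_observes hi]
    have h1 := exp_neg_one_le_pow_of_le (n := K) (m := A.card - 1) NeZero.one_le (by omega)
    calc Real.exp (-1) / K = 1 / K * Real.exp (-1) := by ring
      _ ≤ _ := by gcongr
  have h1i : Integrable ((observes W A i a t).indicator (1 : Ω → ℝ)) P :=
    (integrable_const (1 : ℝ)).indicator hOm
  have h2i : Integrable (fun ω => (observes W A i a t).indicator (1 : Ω → ℝ) ω *
      Real.exp (2 * ε * g ω)) P := by
    refine (hexpi.indicator hOm).congr (Filter.Eventually.of_forall fun ω => ?_)
    by_cases hω : ω ∈ observes W A i a t <;> simp [hω]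
  -- The integrand is `1` off the observation event and `exp (2εg)` on it, so its mean is `(1 - p) +
  -- p * E[exp (2εg)]`.
  calc ∫ ω, Real.exp (2 * ε * (observes W A i a t).indicator (g) ω) ∂P
      = ∫ ω, ((1 - (observes W A i a t).indicator (1 : Ω → ℝ) ω) +
          (observes W A i a t).indicator (1 : Ω → ℝ) ω * Real.exp (2 * ε * g ω)) ∂P := by
        congr 1 with ω
        by_cases hω : ω ∈ observes W A i a t <;> simp [hω]
    _ = (1 - p) + p * ∫ ω, Real.exp (2 * ε * g ω) ∂P := by
        have h3i : Integrable (fun ω => 1 - (observes W A i a t).indicator (1 : Ω → ℝ) ω) P :=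
          (integrable_const (1 : ℝ)).sub h1i
        rw [integral_add h3i h2i, hprod,
          integral_sub (integrable_const _) h1i, integral_indicator_one hOm]
        simp [hp]
    _ ≤ (1 - p) + p * (1 - 1 / 3 * ε ^ 2) := by
        gcongr
    _ = 1 - p * (1 / 3 * ε ^ 2) := by ring
    _ ≤ 1 - Real.exp (-1) / K * (1 / 3 * ε ^ 2) := by gcongr
    _ ≤ _ := by
        have := Real.add_one_le_exp (-(Real.exp (-1) / K * (1 / 3 * ε ^ 2)))
        linarith

/-- Deviations of the empirical means, including the case of no observation. -/
theorem IsModel.measureReal_observes_sum_le (h : IsModel P ν X W) {mean : Fin K → ℝ}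
    (hmean : ∀ k, mean k = ∫ y, y ∂(ν k)) (hi : i ∈ A) (hA : A.card ≤ K) (a : Fin K)
    (S : Finset ℕ) {ε s : ℝ} (hε : 0 < ε) (hε1 : ε ≤ 1) (hs : s ^ 2 = 1) :
    P.real {ω | 0 ≤ ∑ t ∈ S, (observes W A i a t).indicator
      (fun ω => s * (X a t ω - mean a) - ε / 2) ω} ≤
      Real.exp (-(Real.exp (-1) / K * (1 / 3 * ε ^ 2))) ^ S.card := by
  have hsabs : |s| = 1 := by
    rw [← Real.sqrt_sq_eq_abs, hs, Real.sqrt_one]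
  set g : ℕ → Ω → ℝ := fun t ω => s * (X a t ω - mean a) - ε / 2 with hg
  have hset : {ω | 0 ≤ ∑ t ∈ S, (observes W A i a t).indicator (g t) ω} =
      {ω | 0 ≤ ∑ t ∈ S, 2 * ε * (observes W A i a t).indicator (g t) ω} := by
    ext ω
    simp only [Set.mem_ofPred_eq, ← Finset.mul_sum]
    exact (mul_nonneg_iff_of_pos_left (by positivity)).symm
  rw [hset]
  have hO : ∀ t, MeasurableSet[sigmaOf X W (seedsOf K ι t)] (observes W A i a t) := fun t =>
    measurableSet_observes (S := seedsOf K ι t) (fun j => ⟨j, rfl⟩) a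
  have hgm : ∀ t, Measurable[sigmaOf X W {Sum.inl (a, t)}] (g t) := by
    intro t
    let : MeasurableSpace Ω := sigmaOf X W {Sum.inl (a, t)}
    have h1 : Measurable (X a t) := measurable_sigmaOf_reward (Set.mem_singleton _)
    exact ((h1.sub_const _).const_mul _).sub_const _
  have hsub1 : ∀ t, seedsOf K ι t ⊆ roundBlock K ι t := by
    rintro t _ ⟨j, rfl⟩; rfl
  have hsub2 : ∀ t, ({Sum.inl (a, t)} : Set (Fin K × ℕ ⊕ ι × ℕ)) ⊆ roundBlock K ι t := by
    rintro t _ rfl; rfl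
  have hgb : ∀ t, ∀ᵐ ω ∂P, g t ω ≤ 1 + |mean a| := by
    intro t
    filter_upwards [h.reward_mem_Icc a t] with ω hω
    have h1 : s * (X a t ω - mean a) ≤ 1 + |mean a| := by
      refine (le_abs_self _).trans ?_
      rw [abs_mul, hsabs, one_mul]
      refine (abs_sub _ _).trans ?_
      rw [abs_of_nonneg hω.1]
      linarith [hω.2]
    simp only [hg]
    linarith
  refine h.measureReal_sum_nonneg_le
    (Z := fun t ω => 2 * ε * (observes W A i a t).indicator (g t) ω)
    (B := 2 * ε * (1 + |mean a|)) (fun t _ => ?_) (fun t _ => ?_) (fun t _ => ?_)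
  · exact (((hgm t).mono (sigmaOf_mono (hsub2 t)) le_rfl).indicator
      (sigmaOf_mono (hsub1 t) _ (hO t))).const_mul _
  · filter_upwards [hgb t] with ω hω
    gcongr
    exact Set.indicator_le' (fun _ _ => hω) (fun _ _ => by positivity) ω
  exact h.integral_exp_observes_le hmean hi hA a hε hε1 hs rfl (hgm t) (hgb t)

end LearningPhase

/-! ### The learning length makes the failure probabilities small -/

section Parameters

variable {K T : ℕ} {ε δ : ℝ}

theorem one_lt_four_mul_div (hT : 1 ≤ T) (hδ : 0 < δ) (hδ1 : δ < 1) : 4 < 4 * (T : ℝ) / δ := by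
  have hT' : (1 : ℝ) ≤ T := by exact_mod_cast hT
  rw [lt_div_iff₀ hδ]
  nlinarith

theorem le_learningRounds_collision :
    (K : ℝ) ^ 2 * Real.log (4 * T / δ) / 0.02 ≤ learningRounds K T ε δ :=
  ((le_max_right _ _).trans (le_max_right _ _)).trans (Nat.le_ceil _)

theorem le_learningRounds_ranking :
    16 * (K : ℝ) / ε ^ 2 * Real.log (4 * (K : ℝ) ^ 2 / (δ / (2 * T))) ≤ learningRounds K T ε δ :=
  ((le_max_left _ _).trans (le_max_right _ _)).trans (Nat.le_ceil _)

/-- Consequently the number of learning phases within `T` rounds, times `K`, is at most `T`, as the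
union bound requires. -/
theorem le_learningRounds (hK : 1 ≤ K) (hT : 1 ≤ T) (hδ : 0 < δ) (hδ1 : δ < 1) :
    K ≤ learningRounds K T ε δ := by
  have h1 := le_learningRounds_collision (K := K) (T := T) (ε := ε) (δ := δ)
  have hK' : (1 : ℝ) ≤ K := by exact_mod_cast hK
  have h4 := one_lt_four_mul_div hT hδ hδ1
  have h2 : 1 ≤ Real.log (4 * T / δ) := by
    rw [Real.le_log_iff_exp_le (by linarith)]
    linarith [Real.exp_one_lt_d9]
  have h3 : (K : ℝ) ≤ (K : ℝ) ^ 2 * Real.log (4 * T / δ) / 0.02 := by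
    rw [le_div_iff₀ (by norm_num)]
    nlinarith
  exact_mod_cast h3.trans h1

theorem exp_pow_learningRounds_collision_le (hK : 1 ≤ K) (hT : 1 ≤ T) (hδ : 0 < δ)
    (hδ1 : δ < 1) :
    Real.exp (-2 * (0.1 / (K : ℝ)) ^ 2) ^ learningRounds K T ε δ ≤ δ / (4 * T) := by
  have hK' : (0 : ℝ) < K := by exact_mod_cast hK
  have h4 := one_lt_four_mul_div hT hδ hδ1
  have h1 := le_learningRounds_collision (K := K) (T := T) (ε := ε) (δ := δ)
  rw [div_le_iff₀ (by norm_num)] at h1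
  rw [← Real.exp_nat_mul, ← inv_div (4 * (T : ℝ)) δ, ← Real.exp_log (show 0 < 4 * (T : ℝ) / δ by linarith),
    ← Real.exp_neg]
  apply Real.exp_le_exp.2
  -- The divisor `0.02` in the definition is `2 * 0.1^2`, from accuracy `0.1 / K` in Hoeffding's
  -- bound.
  have h2 : (learningRounds K T ε δ : ℝ) * (-2 * (0.1 / (K : ℝ)) ^ 2) =
      -((learningRounds K T ε δ : ℝ) * 0.02 / K ^ 2) := by
    field_simp
    ring
  rw [h2]
  apply neg_le_neg
  rw [le_div_iff₀ (by positivity)]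
  linarith

/-- The prefactor `16K/ε²` times the decay rate `ε²/(3eK)` equals `16/(3e) > 1`, and the logarithm
in the definition has an argument at least `4TK/δ`. -/
theorem exp_pow_learningRounds_ranking_le (hK : 1 ≤ K) (hT : 1 ≤ T) (hε : 0 < ε) (hδ : 0 < δ)
    (hδ1 : δ < 1) :
    Real.exp (-(Real.exp (-1) / K * (1 / 3 * ε ^ 2))) ^ learningRounds K T ε δ ≤
      δ / (4 * T * K) := by
  have hK' : (1 : ℝ) ≤ K := by exact_mod_cast hK
  have hT' : (1 : ℝ) ≤ T := by exact_mod_cast hT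
  have h1 := le_learningRounds_ranking (K := K) (T := T) (ε := ε) (δ := δ)
  have he : (0.36 : ℝ) < Real.exp (-1) := by
    have := Real.exp_neg_one_gt_d9
    linarith
  have hpos : 0 < 4 * (T : ℝ) * K / δ := by positivity
  rw [← Real.exp_nat_mul, ← inv_div (4 * (T : ℝ) * K) δ, ← Real.exp_log hpos, ← Real.exp_neg]
  apply Real.exp_le_exp.2
  rw [mul_neg]
  apply neg_le_neg
  have hle : 4 * (T : ℝ) * K / δ ≤ 4 * (K : ℝ) ^ 2 / (δ / (2 * T)) := by
    rw [div_div_eq_mul_div]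
    refine div_le_div_of_nonneg_right ?_ hδ.le
    have : (K : ℝ) ≤ K ^ 2 := by nlinarith
    nlinarith [mul_le_mul_of_nonneg_left this (by linarith : (0 : ℝ) ≤ T)]
  have hlog : Real.log (4 * (T : ℝ) * K / δ) ≤ Real.log (4 * (K : ℝ) ^ 2 / (δ / (2 * T))) :=
    Real.log_le_log hpos hle
  have hone : 1 ≤ 4 * (T : ℝ) * K / δ := by
    rw [one_le_div hδ]
    nlinarith
  have hlog0 : 0 ≤ Real.log (4 * (T : ℝ) * K / δ) := Real.log_nonneg hone
  have h2 : 16 * (K : ℝ) / ε ^ 2 * Real.log (4 * (T : ℝ) * K / δ) ≤ learningRounds K T ε δ :=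
    (mul_le_mul_of_nonneg_left hlog (by positivity)).trans h1
  calc Real.log (4 * (T : ℝ) * K / δ)
      ≤ (16 / 3 * Real.exp (-1)) * Real.log (4 * (T : ℝ) * K / δ) :=
        le_mul_of_one_le_left hlog0 (by linarith)
    _ = (16 * (K : ℝ) / ε ^ 2 * Real.log (4 * (T : ℝ) * K / δ)) *
        (Real.exp (-1) / K * (1 / 3 * ε ^ 2)) := by field_simp
    _ ≤ _ := by gcongr

end Parameters

/-! ### Probability of the good event -/

section GoodEvent

theorem IsSchedule.active_eq_of_mem {ι : Type*} [DecidableEq ι] {active : ℕ → Finset ι}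
    {Nm T x T0 T1 k : ℕ} (hs : IsSchedule active Nm T x T0 T1) (hT1 : T0 ≤ T1)
    (hk : k * T1 + T0 ≤ T) {t : ℕ} (ht : t ∈ learningWindow T0 T1 k) :
    active t = active (k * T1) := by
  obtain ⟨h1, h2⟩ := Finset.mem_Ico.1 ht
  obtain ⟨s, rfl⟩ := Nat.exists_eq_add_of_le h1
  clear ht h1
  induction s with
  | zero => rfl
  | succ s ih =>
    have hmod : (k * T1 + s + 1) % T1 = s + 1 := by
      rw [add_assoc, mul_comm, Nat.mul_add_mod, Nat.mod_eq_of_lt (by omega)]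
    rw [← add_assoc, hs.learning (k * T1 + s) (by omega) (by omega) (by omega)]
    exact ih (by omega)

variable {Ω ι : Type*} [MeasurableSpace Ω] {K : ℕ} [NeZero K] {P : Measure Ω}
  [IsProbabilityMeasure P] {ν : Fin K → Measure ℝ} {X : Fin K → ℕ → Ω → ℝ} {W : ι → ℕ → Ω → ℝ}
  {active : ℕ → Finset ι} {mean : Fin K → ℝ} {Nm T x T0 T1 k : ℕ} {ε δ : ℝ} {i : ι}

/-- The probability that a player is unsuccessful in some learning phase. -/
theorem IsModel.measureReal_learning_fails_le (h : IsModel P ν X W)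
    (hmean : ∀ k, mean k = ∫ y, y ∂(ν k)) (hT : 1 ≤ T) (hε : 0 < ε) (hδ : 0 < δ) (hδ1 : δ < 1)
    (hT0 : T0 = learningRounds K T ε δ) (hcard : (active (k * T1)).card ≤ K)
    (hact : ∀ t ∈ learningWindow T0 T1 k, active t = active (k * T1))
    (hi : i ∈ active (k * T1)) :
    P.real {ω | ¬ (playerEstimate T0 T1 active (fun i t => W i t ω) K k i =
        (active (k * T1)).card ∧ IsCorrectRanking mean ε
      (ranking (empMean T0 T1 active (fun i t => W i t ω) (fun a t => X a t ω) k i)))} ≤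
      δ / T := by
  classical
  have hK : 1 ≤ K := NeZero.one_le
  have hK' : (0 : ℝ) < K := by exact_mod_cast hK
  have hT' : (0 : ℝ) < T := by exact_mod_cast hT
  set A := active (k * T1) with hA
  have hKT0 : K ≤ T0 := hT0 ▸ le_learningRounds hK hT hδ hδ1
  let E : ℝ → Set Ω := fun s => {ω | 0 ≤ ∑ t ∈ learningWindow T0 T1 k,
    (s * ((noCollision K W A i t).indicator 1 ω - (1 - 1 / K) ^ (A.card - 1)) - 0.1 / K)}
  -- For `ε > 1` nothing has to be excluded: the means lie in `[0, 1]`, so every ranking is correct.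
  let F : Fin K → ℝ → Set Ω := fun a s => if ε ≤ 1 then
    {ω | 0 ≤ ∑ t ∈ learningWindow T0 T1 k, (observes W A i a t).indicator
      (fun ω => s * (X a t ω - mean a) - ε / 2) ω} else ∅
  have hE : ∀ s : ℝ, s ^ 2 = 1 → P.real (E s) ≤ δ / (4 * T) := by
    intro s hs
    refine (h.measureReal_noCollision_sum_le hi _ (by positivity) hs).trans ?_
    rw [card_learningWindow, hT0]
    exact exp_pow_learningRounds_collision_le hK hT hδ hδ1
  have hF : ∀ a, ∀ s : ℝ, s ^ 2 = 1 → P.real (F a s) ≤ δ / (4 * T * K) := by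
    intro a s hs
    dsimp only [F]
    split_ifs with hε1
    · refine (h.measureReal_observes_sum_le hmean hi hcard a _ hε hε1 hs).trans ?_
      rw [card_learningWindow, hT0]
      exact exp_pow_learningRounds_ranking_le hK hT hε hδ hδ1
    · rw [measureReal_empty]
      positivity
  have hsub : {ω | ¬ (playerEstimate T0 T1 active (fun i t => W i t ω) K k i = A.card ∧
      IsCorrectRanking mean ε
      (ranking (empMean T0 T1 active (fun i t => W i t ω) (fun a t => X a t ω) k i)))} ⊆
      (E 1 ∪ E (-1)) ∪ ⋃ a, (F a 1 ∪ F a (-1)) := by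
    intro ω hω
    by_contra hcon
    simp only [Set.mem_union, Set.mem_iUnion, not_or, not_exists] at hcon
    obtain ⟨⟨h1, h2⟩, h3⟩ := hcon
    refine hω ⟨?_, ?_⟩
    · refine playerEstimate_eq (by omega) hi hcard hact ?_ ?_
      · refine lt_of_eq_of_lt (Finset.sum_congr rfl fun t _ => ?_) (not_le.1 h1)
        by_cases hc : Collides A (fun j => exploreArm K (W j t ω)) i
        · rw [if_pos hc, Set.indicator_of_notMem
            (show ω ∉ noCollision K W A i t from fun hn => hn hc)]; ring
        · rw [if_neg hc, Set.indicator_of_mem (show ω ∈ noCollision K W A i t from hc)]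
          simp only [Pi.one_apply]; ring
      · refine lt_of_eq_of_lt (Finset.sum_congr rfl fun t _ => ?_) (not_le.1 h2)
        by_cases hc : Collides A (fun j => exploreArm K (W j t ω)) i
        · rw [if_pos hc, Set.indicator_of_notMem
            (show ω ∉ noCollision K W A i t from fun hn => hn hc)]; ring
        · rw [if_neg hc, Set.indicator_of_mem (show ω ∈ noCollision K W A i t from hc)]
          simp only [Pi.one_apply]; ring
    · by_cases hε1 : ε ≤ 1
      · refine isCorrectRanking_of_bounds fun a => ?_
        have h4 := h3 a
        simp only [F, if_pos hε1] at h4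
        refine empMean_bounds hact ?_ ?_
        · refine lt_of_eq_of_lt (Finset.sum_congr rfl fun t _ => ?_) (not_le.1 h4.1)
          simp only [Set.indicator_apply, observes, Set.mem_ofPred_eq, one_mul]
        · refine lt_of_eq_of_lt (Finset.sum_congr rfl fun t _ => ?_) (not_le.1 h4.2)
          simp only [Set.indicator_apply, observes, Set.mem_ofPred_eq, neg_one_mul]
      · intro a b hab
        have h5 := (h.mean_mem_Icc a).2
        have h6 := (h.mean_mem_Icc b).1
        rw [← hmean] at h5 h6
        exact absurd (hab.trans (by linarith)) hε1
  calc _ ≤ P.real ((E 1 ∪ E (-1)) ∪ ⋃ a, (F a 1 ∪ F a (-1))) := measureReal_mono hsub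
    _ ≤ (P.real (E 1) + P.real (E (-1))) + ∑ a, (P.real (F a 1) + P.real (F a (-1))) := by
        refine (measureReal_union_le _ _).trans (add_le_add (measureReal_union_le _ _) ?_)
        exact (measureReal_iUnion_fintype_le _).trans
          (Finset.sum_le_sum fun a _ => measureReal_union_le _ _)
    -- Half of the budget `δ/T` goes to the two collision deviations, half to the `2K` deviations of
    -- empirical means.
    _ ≤ (δ / (4 * T) + δ / (4 * T)) + ∑ a : Fin K, (δ / (4 * T * K) + δ / (4 * T * K)) := by
        gcongr <;> first | exact hE _ (by norm_num) | exact hF _ _ (by norm_num)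
    _ = δ / T := by
        rw [Finset.sum_const, Finset.card_univ, Fintype.card_fin, nsmul_eq_mul]
        field_simp
        norm_num

/-- A union bound over at most `T / T0` completed learning phases and at most `K` players in each,
every pair failing with probability at most `δ/T`. -/
theorem IsModel.one_sub_le_goodEvent [DecidableEq ι] (h : IsModel P ν X W)
    (hmean : ∀ k, mean k = ∫ y, y ∂(ν k)) (hT : 1 ≤ T) (hε : 0 < ε) (hδ : 0 < δ) (hδ1 : δ < 1)
    (hT0 : T0 = learningRounds K T ε δ) (hT1 : T0 ≤ T1) (hNm : Nm ≤ K)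
    (hs : IsSchedule active Nm T x T0 T1) :
    1 - δ ≤ P.real (goodEvent mean ε T T0 T1 active X W) := by
  have hK : 1 ≤ K := NeZero.one_le
  have hT' : (0 : ℝ) < T := by exact_mod_cast hT
  have hKT0 : K ≤ T0 := hT0 ▸ le_learningRounds hK hT hδ hδ1
  have hm : MeasurableSet (goodEvent mean ε T T0 T1 active X W) :=
    measurableSet_goodEvent (fun i t _ => h.measurable_seed i t) hT1 h.measurable_reward mean ε T
  let fails : ℕ → ι → Set Ω := fun k i =>
    {ω | ¬ (playerEstimate T0 T1 active (fun i t => W i t ω) K k i =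
        (active (k * T1)).card ∧ IsCorrectRanking mean ε
      (ranking (empMean T0 T1 active (fun i t => W i t ω) (fun a t => X a t ω) k i)))}
  let epochs := (Finset.range (T / T0)).filter fun k => k * T1 + T0 ≤ T
  have hsub : (goodEvent mean ε T T0 T1 active X W)ᶜ ⊆
      ⋃ k ∈ epochs, ⋃ i ∈ active (k * T1), fails k i := by
    intro ω hω
    simp only [goodEvent, Set.mem_compl_iff, Set.mem_ofPred_eq, not_forall] at hω
    obtain ⟨k, hk, i, hi, hfail⟩ := hω
    refine Set.mem_biUnion (Finset.mem_filter.2 ⟨?_, hk⟩) (Set.mem_biUnion hi hfail)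
    rw [Finset.mem_range, ← Nat.succ_le_iff, Nat.le_div_iff_mul_le (by omega), Nat.succ_mul]
    have := Nat.mul_le_mul_left k hT1
    omega
  have hle : P.real (goodEvent mean ε T T0 T1 active X W)ᶜ ≤ δ := by
    calc _ ≤ P.real (⋃ k ∈ epochs, ⋃ i ∈ active (k * T1), fails k i) :=
        measureReal_mono hsub (measure_ne_top _ _)
      _ ≤ ∑ k ∈ epochs, ∑ i ∈ active (k * T1), P.real (fails k i) :=
        (measureReal_biUnion_finset_le _ _).trans
          (Finset.sum_le_sum fun k _ => measureReal_biUnion_finset_le _ _)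
      _ ≤ ∑ k ∈ epochs, (K : ℝ) * (δ / T) := by
        refine Finset.sum_le_sum fun k hk => ?_
        have hk' := (Finset.mem_filter.1 hk).2
        have hcard : (active (k * T1)).card ≤ K := (hs.card_le _ (by omega)).trans hNm
        calc ∑ i ∈ active (k * T1), P.real (fails k i)
            ≤ ∑ i ∈ active (k * T1), δ / T := Finset.sum_le_sum fun i hi =>
              h.measureReal_learning_fails_le hmean hT hε hδ hδ1 hT0 hcard
                (fun t ht => hs.active_eq_of_mem hT1 hk' ht) hi
          _ = (active (k * T1)).card * (δ / T) := by rw [Finset.sum_const, nsmul_eq_mul]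
          _ ≤ K * (δ / T) := by gcongr
      _ = epochs.card * (K * (δ / T)) := by rw [Finset.sum_const, nsmul_eq_mul]
      _ = (epochs.card * K : ℕ) / T * δ := by push_cast; ring
      _ ≤ 1 * δ := by
        gcongr
        rw [div_le_one hT']
        have h1 : epochs.card ≤ T / T0 :=
          (Finset.card_filter_le _ _).trans_eq (Finset.card_range _)
        have h2 : epochs.card * K ≤ T :=
          (Nat.mul_le_mul h1 hKT0).trans (Nat.div_mul_le_self T T0)
        exact_mod_cast h2
      _ = δ := one_mul δ
  rw [probReal_compl_eq_one_sub hm] at hle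
  linarith

end GoodEvent

/-! ### Counting rounds by epoch and position -/

section Counting

variable {T T0 T1 : ℕ}

theorem div_lt_numEpochs (hT1 : 0 < T1) {t : ℕ} (ht : t < T) : t / T1 < numEpochs T T1 := by
  rw [numEpochs, Nat.lt_ceil]
  refine Nat.cast_div_le.trans_lt ?_
  have : (t : ℝ) < T := by exact_mod_cast ht
  gcongr

theorem eq_of_div_eq_of_mod_eq {s t : ℕ} (h1 : s / T1 = t / T1) (h2 : s % T1 = t % T1) :
    s = t := by
  rw [← Nat.div_add_mod s T1, ← Nat.div_add_mod t T1, h1, h2]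

theorem card_learning_rounds_le (hT1 : 0 < T1) :
    ((Finset.range T).filter fun t => t % T1 < T0).card ≤ numEpochs T T1 * T0 := by
  rw [← Finset.card_range (numEpochs T T1), ← Finset.card_range T0, ← Finset.card_product,
    Finset.card_range]
  refine Finset.card_le_card_of_injOn (fun t => (t / T1, t % T1)) (fun t ht => ?_)
    fun s _ t _ hst => eq_of_div_eq_of_mod_eq (Prod.ext_iff.1 hst).1 (Prod.ext_iff.1 hst).2
  obtain ⟨h1, h2⟩ := Finset.mem_filter.1 ht
  exact Finset.mem_product.2 ⟨Finset.mem_range.2 (div_lt_numEpochs hT1 (Finset.mem_range.1 h1)),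
    Finset.mem_range.2 h2⟩

/-- The minimum with `T` covers an epoch length beyond the horizon, which the second choice of `T1`
allows. -/
theorem card_rounds_of_epochs_le (hT1 : 0 < T1) (D : Finset ℕ) :
    ((Finset.range T).filter fun t => t / T1 ∈ D).card ≤ D.card * min T1 T := by
  rw [← Finset.card_range (min T1 T), ← Finset.card_product]
  refine Finset.card_le_card_of_injOn (fun t => (t / T1, t % T1)) (fun t ht => ?_)
    fun s _ t _ hst => eq_of_div_eq_of_mod_eq (Prod.ext_iff.1 hst).1 (Prod.ext_iff.1 hst).2
  obtain ⟨h1, h2⟩ := Finset.mem_filter.1 ht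
  exact Finset.mem_product.2 ⟨h2, Finset.mem_range.2 (lt_min (Nat.mod_lt _ hT1)
    ((Nat.mod_le _ _).trans_lt (Finset.mem_range.1 h1)))⟩

theorem sum_geometric_rounds_le (hT1 : 0 < T1) {q : ℝ} (hq0 : 0 ≤ q) (hq1 : q < 1) :
    ∑ t ∈ (Finset.range T).filter (fun t => T0 ≤ t % T1), q ^ (t % T1 - T0) ≤
      numEpochs T T1 * (1 - q)⁻¹ := by
  set φ : ℕ → ℕ × ℕ := fun t => (t / T1, t % T1 - T0) with hφ
  have hinj : Set.InjOn φ ((Finset.range T).filter fun t => T0 ≤ t % T1) := by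
    intro s hs t ht hst
    have hs' := (Finset.mem_filter.1 hs).2
    have ht' := (Finset.mem_filter.1 ht).2
    have h2 : s % T1 - T0 = t % T1 - T0 := (Prod.ext_iff.1 hst).2
    exact eq_of_div_eq_of_mod_eq (Prod.ext_iff.1 hst).1 (by omega)
  calc ∑ t ∈ (Finset.range T).filter (fun t => T0 ≤ t % T1), q ^ (t % T1 - T0)
      = ∑ z ∈ ((Finset.range T).filter fun t => T0 ≤ t % T1).image φ, q ^ z.2 := by
        rw [Finset.sum_image hinj]
    _ ≤ ∑ z ∈ Finset.range (numEpochs T T1) ×ˢ Finset.range T1, q ^ z.2 := by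
        refine Finset.sum_le_sum_of_subset_of_nonneg ?_ fun z _ _ => pow_nonneg hq0 _
        intro z hz
        obtain ⟨t, ht, rfl⟩ := Finset.mem_image.1 hz
        exact Finset.mem_product.2 ⟨Finset.mem_range.2 (div_lt_numEpochs hT1
          (Finset.mem_range.1 (Finset.mem_filter.1 ht).1)), Finset.mem_range.2
          ((Nat.sub_le _ _).trans_lt (Nat.mod_lt _ hT1))⟩
    _ = numEpochs T T1 * ∑ s ∈ Finset.range T1, q ^ s := by
        simp only [Finset.sum_product, Finset.sum_const, Finset.card_range, nsmul_eq_mul]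
    _ ≤ numEpochs T T1 * (1 - q)⁻¹ := by
        gcongr
        rw [← tsum_geometric_of_lt_one hq0 hq1]
        exact (summable_geometric_of_lt_one hq0 hq1).sum_le_tsum _ fun s _ => pow_nonneg hq0 s

end Counting

/-! ### Epochs without entries or departures -/

section Schedule

variable {ι : Type*} [DecidableEq ι] {active : ℕ → Finset ι} {Nm T x T0 T1 k t : ℕ}

/-- The epochs that contain a round after which somebody enters or leaves. -/
def changingEpochs (active : ℕ → Finset ι) (T T1 : ℕ) : Finset ℕ :=
  ((Finset.range (T - 1)).filter fun s => active s ≠ active (s + 1)).image (· / T1)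

/-- Each such epoch contains a round contributing at least one to the total number of changes. A
change at a boundary is charged to the epoch that ends. -/
theorem IsSchedule.card_changingEpochs_le (hs : IsSchedule active Nm T x T0 T1) :
    (changingEpochs active T T1).card ≤ x := by
  refine Finset.card_image_le.trans (le_trans ?_ hs.changes)
  rw [Finset.card_filter]
  refine Finset.sum_le_sum fun s _ => ?_
  split_ifs with h
  · rw [Nat.one_le_iff_ne_zero, Finset.card_ne_zero, Finset.nonempty_iff_ne_empty]
    exact fun h0 => h (symmDiff_eq_bot.1 h0)
  · exact Nat.zero_le _

theorem active_eq_of_notMem_changingEpochs (hk : k ∉ changingEpochs active T T1)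
    (ht : t < T) (ht1 : t < (k + 1) * T1) {s : ℕ} (h1 : k * T1 ≤ s) (h2 : s ≤ t) :
    active s = active (k * T1) := by
  obtain ⟨n, rfl⟩ := Nat.exists_eq_add_of_le h1
  clear h1
  induction n with
  | zero => rfl
  | succ n ih =>
    rw [← ih (by omega)]
    by_contra hne
    refine hk (Finset.mem_image.2 ⟨k * T1 + n, Finset.mem_filter.2
      ⟨Finset.mem_range.2 (by omega), fun h => hne ?_⟩, ?_⟩)
    · rw [h]; rfl
    · exact Nat.div_eq_of_lt_le (by omega) (by omega)

variable {Ω : Type*} {K : ℕ} [NeZero K] {X : Fin K → ℕ → Ω → ℝ} {W : ι → ℕ → Ω → ℝ}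
  {mean : Fin K → ℝ} {ε : ℝ}

/-- A round `t < T` past the learning rounds witnesses that the learning phase of its epoch ended
within the horizon, so the good event covers that epoch. -/
theorem isReady_of_mem_goodEvent (hNm : Nm ≤ K)
    (hgap : ∀ (j : ℕ) (hj : j + 1 < K), j < Nm →
      ε ≤ mean (ranking mean ⟨j, Nat.lt_of_succ_lt hj⟩) - mean (ranking mean ⟨j + 1, hj⟩))
    (hs : IsSchedule active Nm T x T0 T1) (hT1 : 0 < T1) (ht : t < T) (hmod : T0 ≤ t % T1)
    (hk : t / T1 ∉ changingEpochs active T T1) {ω : Ω}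
    (hω : ω ∈ goodEvent mean ε T T0 T1 active X W) :
    IsReady T0 T1 active (fun i t => W i t ω) (fun a t => X a t ω) mean (t / T1) t := by
  have hdm := Nat.div_add_mod t T1
  rw [mul_comm] at hdm
  have hlt : t < (t / T1 + 1) * T1 := by
    have := Nat.mod_lt t hT1
    rw [Nat.succ_mul]
    omega
  have hcard := hs.card_le (t / T1 * T1) (by omega)
  have hgood := hω (t / T1) (by omega)
  exact {
    start_le := by omega
    lt_end := hlt
    const := fun s h1 h2 => active_eq_of_notMem_changingEpochs hk ht hlt h1 h2
    card_le := hcard.trans hNm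
    estimate := fun i hi => (hgood i hi).1
    rank := fun i hi j hj => (hgood i hi).2.apply_eq hgap j (hj.trans_le hcard) }

end Schedule

/-! ### Expected regret conditionally on the good event -/

section Regret

/-- A crude bound that serves only for integrability. -/
theorem neg_card_le_roundRegret {ι : Type*} {K : ℕ} [NeZero K] {active : ℕ → Finset ι}
    {T0 T1 t : ℕ} {mean : Fin K → ℝ} (h0 : ∀ a, 0 ≤ mean a) (h1 : ∀ a, mean a ≤ 1)
    (u : ι → ℕ → ℝ) (Y : Fin K → ℕ → ℝ) :
    -((active t).card : ℝ) ≤ roundRegret T0 T1 active u Y mean t := by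
  have ha : 0 ≤ ∑ j : Fin K, if (j : ℕ) < (active t).card then mean (ranking mean j) else 0 :=
    Finset.sum_nonneg fun j _ => by
      split_ifs
      exacts [h0 _, le_rfl]
  have hb : ∀ i ∈ active t, mean (action T0 T1 active u Y t i) *
      (1 - open Classical in
        if Collides (active t) (action T0 T1 active u Y t) i then (1 : ℝ) else 0) ≤ 1 := by
    intro i _
    split_ifs
    · simp
    · simpa using h1 _
  have hc := Finset.sum_le_sum hb
  rw [Finset.sum_const, nsmul_eq_mul, mul_one] at hc
  rw [roundRegret]
  linarith

variable {ι : Type*} {active : ℕ → Finset ι} {Nm T x T0 T1 k t : ℕ}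

variable {Ω : Type*} {K : ℕ} [NeZero K] {X : Fin K → ℕ → Ω → ℝ} {W : ι → ℕ → Ω → ℝ}
  {mean : Fin K → ℝ} {ε : ℝ}

/-- This is why conditioning on the good event does not bias the draws of Musical Chairs. -/
theorem measurableSet_goodEvent_offRound (hT : T0 ≤ T1) (hmod : T0 ≤ t % T1) :
    MeasurableSet[sigmaOf X W (offRound K ι t)] (goodEvent mean ε T T0 T1 active X W) := by
  let : MeasurableSpace Ω := sigmaOf X W (offRound K ι t)
  refine measurableSet_goodEvent (fun i s hs => measurable_sigmaOf_seed fun i' hi' => ?_) hT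
    (fun a s => measurable_sigmaOf_reward fun i' hi' => by simp at hi') mean ε T
  have : s = t := congrArg Prod.snd (Sum.inr_injective hi')
  subst this
  omega

variable [MeasurableSpace Ω] {P : Measure Ω} {ν : Fin K → Measure ℝ}

theorem integrable_roundRegret (h : IsModel P ν X W) (hT : T0 ≤ T1) (h0 : ∀ a, 0 ≤ mean a)
    (h1 : ∀ a, mean a ≤ 1) (t : ℕ) (Q : Measure Ω) [IsFiniteMeasure Q] :
    Integrable (fun ω => roundRegret T0 T1 active (fun i t => W i t ω) (fun a t => X a t ω)
      mean t) Q :=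
  Integrable.of_mem_Icc _ _
    (measurable_roundRegret h.measurable_seed hT h.measurable_reward mean t).aemeasurable
    (Filter.Eventually.of_forall fun _ =>
      ⟨neg_card_le_roundRegret h0 h1 _ _, roundRegret_le h0 h1⟩)

variable [DecidableEq ι]

/-- The expected regret of a round of Musical Chairs in an epoch without changes. -/
theorem IsModel.integral_roundRegret_le [IsProbabilityMeasure P] (h : IsModel P ν X W) (h0 : ∀ a, 0 ≤ mean a)
    (h1 : ∀ a, mean a ≤ 1) (hNm : Nm ≤ K)
    (hgap : ∀ (j : ℕ) (hj : j + 1 < K), j < Nm →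
      ε ≤ mean (ranking mean ⟨j, Nat.lt_of_succ_lt hj⟩) - mean (ranking mean ⟨j + 1, hj⟩))
    (hs : IsSchedule active Nm T x T0 T1) (hT : T0 ≤ T1) (hT1 : 0 < T1) (ht : t < T)
    (hmod : T0 ≤ t % T1) (hk : t / T1 ∉ changingEpochs active T T1)
    (hG : 0 < P.real (goodEvent mean ε T T0 T1 active X W)) :
    ∫ ω, roundRegret T0 T1 active (fun i t => W i t ω) (fun a t => X a t ω) mean t
      ∂(cond P (goodEvent mean ε T T0 T1 active X W)) ≤
      K * (K * (1 - Real.exp (-1) / K) ^ (t % T1 - T0)) := by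
  set G := goodEvent mean ε T T0 T1 active X W with hGdef
  have hGm : MeasurableSet G :=
    measurableSet_goodEvent (fun i t _ => h.measurable_seed i t) hT h.measurable_reward mean ε T
  have hG0 : P G ≠ 0 := fun hz => by simp [measureReal_def, hz] at hG
  have : IsProbabilityMeasure (cond P G) := cond_isProbabilityMeasure hG0
  set A := active (t / T1 * T1) with hA
  set U : ι → Set Ω := fun i => {ω | fixedArm T0 T1 active (fun i t => W i t ω)
    (fun a t => X a t ω) t i = none} with hU
  have hUm : ∀ i, MeasurableSet (U i) := fun i =>
    ((measurable_fixedArm (fun i t _ => h.measurable_seed i t) hT h.measurable_reward t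
      (fun i s _ => h.measurable_seed i s) i).eq measurable_const).setOf
  have hready := fun ω hω => isReady_of_mem_goodEvent (X := X) (W := W) (ω := ω) hNm hgap hs hT1
    ht hmod hk hω
  have hcard : A.card ≤ K := (hs.card_le _ ((Nat.div_mul_le_self t T1).trans_lt ht)).trans hNm
  have hq : 0 ≤ 1 - Real.exp (-1) / K := by
    have hK : (1 : ℝ) ≤ K := by exact_mod_cast NeZero.one_le
    have h1 : Real.exp (-1) / K ≤ Real.exp (-1) := div_le_self (Real.exp_pos _).le hK
    have h2 : Real.exp (-1) ≤ 1 := Real.exp_le_one_iff.2 (by norm_num)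
    linarith
  have hUle : ∀ i ∈ A, (cond P G).real (U i) ≤ (1 - Real.exp (-1) / K) ^ (t % T1 - T0) := by
    intro i hi
    have hts : t / T1 * T1 + T0 + (t % T1 - T0) = t := by
      have := Nat.div_add_mod t T1
      rw [mul_comm] at this
      omega
    have := h.measureReal_unfixed_le (active := active) (mean := mean) (k := t / T1) (G := G) hT
      (fun t' ht' => measurableSet_goodEvent_offRound hT ht') hi (t % T1 - T0)
    rw [hts] at this
    have h2 := this hready
    rw [measureReal_def, cond_apply hGm, ENNReal.toReal_mul, ENNReal.toReal_inv,
      ← measureReal_def, ← measureReal_def, inv_mul_le_iff₀ hG, mul_comm]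
    exact h2
  -- Regret is zero when all are fixed and at most `K` otherwise, hence at most `K` times the number
  -- of unfixed players.
  have hle : ∀ᵐ ω ∂(cond P G), roundRegret T0 T1 active (fun i t => W i t ω)
      (fun a t => X a t ω) mean t ≤ K * ∑ i ∈ A, (U i).indicator 1 ω := by
    filter_upwards [ae_cond_mem hGm] with ω hω
    have hind : ∀ i ∈ A, 0 ≤ (U i).indicator (1 : Ω → ℝ) ω := fun i _ =>
      Set.indicator_nonneg (fun _ _ => zero_le_one) ω
    by_cases hfix : ∀ i ∈ A, fixedArm T0 T1 active (fun i t => W i t ω)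
        (fun a t => X a t ω) t i ≠ none
    · rw [(hready ω hω).roundRegret_eq_zero hfix]
      exact mul_nonneg (Nat.cast_nonneg K) (Finset.sum_nonneg hind)
    · push Not at hfix
      obtain ⟨i, hi, hnone⟩ := hfix
      refine (roundRegret_le h0 h1).trans (le_mul_of_one_le_right (Nat.cast_nonneg K) ?_)
      refine le_trans ?_ (Finset.single_le_sum hind hi)
      rw [Set.indicator_of_mem (show ω ∈ U i from hnone)]
      rfl
  have hint : ∀ i, Integrable ((U i).indicator (1 : Ω → ℝ)) (cond P G) := fun i =>
    (integrable_const (1 : ℝ)).indicator (hUm i)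
  calc _ ≤ ∫ ω, K * ∑ i ∈ A, (U i).indicator (1 : Ω → ℝ) ω ∂(cond P G) :=
        integral_mono_ae (integrable_roundRegret h hT h0 h1 t _)
          ((integrable_finsetSum _ fun i _ => hint i).const_mul _) hle
    _ = K * ∑ i ∈ A, (cond P G).real (U i) := by
        rw [integral_const_mul, integral_finsetSum _ fun i _ => hint i]
        simp only [integral_indicator_one (hUm _)]
    _ ≤ K * ∑ i ∈ A, (1 - Real.exp (-1) / K) ^ (t % T1 - T0) := by
        gcongr with i hi
        exact hUle i hi
    _ = K * (A.card * (1 - Real.exp (-1) / K) ^ (t % T1 - T0)) := by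
        rw [Finset.sum_const, nsmul_eq_mul]
    _ ≤ _ := by gcongr

/-- The expected regret, split into learning rounds, epochs with changes, and Musical Chairs. -/
theorem IsModel.integral_regret_le [IsProbabilityMeasure P] (h : IsModel P ν X W) (h0 : ∀ a, 0 ≤ mean a)
    (h1 : ∀ a, mean a ≤ 1) (hNm : Nm ≤ K)
    (hgap : ∀ (j : ℕ) (hj : j + 1 < K), j < Nm →
      ε ≤ mean (ranking mean ⟨j, Nat.lt_of_succ_lt hj⟩) - mean (ranking mean ⟨j + 1, hj⟩))
    (hs : IsSchedule active Nm T x T0 T1) (hT : T0 ≤ T1) (hT1 : 0 < T1)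
    (hG : 0 < P.real (goodEvent mean ε T T0 T1 active X W)) :
    Integrable (fun ω => regret T0 T1 active (fun i t => W i t ω) (fun a t => X a t ω) mean T)
      (cond P (goodEvent mean ε T T0 T1 active X W)) ∧
    ∫ ω, regret T0 T1 active (fun i t => W i t ω) (fun a t => X a t ω) mean T
      ∂(cond P (goodEvent mean ε T T0 T1 active X W)) ≤
      K * (numEpochs T T1 * T0) + K * min ((x : ℝ) * min (T1 : ℝ) T) T +
        3 * K ^ 3 * numEpochs T T1 := by
  set G := goodEvent mean ε T T0 T1 active X W with hGdef
  have hG0 : P G ≠ 0 := fun hz => by simp [measureReal_def, hz] at hG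
  have : IsProbabilityMeasure (cond P G) := cond_isProbabilityMeasure hG0
  have hint := fun t => integrable_roundRegret (T0 := T0) (active := active) h hT h0 h1 t (cond P G)
  simp only [regret_eq_sum]
  refine ⟨integrable_finsetSum _ fun t _ => hint t, ?_⟩
  rw [integral_finsetSum _ fun t _ => hint t]
  have hK : (1 : ℝ) ≤ K := by exact_mod_cast NeZero.one_le
  set q : ℝ := 1 - Real.exp (-1) / K with hq
  have he : (1 / 3 : ℝ) < Real.exp (-1) := by
    have := Real.exp_neg_one_gt_d9
    linarith
  have hq1 : q < 1 := by
    have : 0 < Real.exp (-1) / K := by positivity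
    linarith
  have hq0 : 0 ≤ q := by
    have h1 : Real.exp (-1) / K ≤ Real.exp (-1) := div_le_self (Real.exp_pos _).le hK
    have h2 : Real.exp (-1) ≤ 1 := Real.exp_le_one_iff.2 (by norm_num)
    linarith
  have hround : ∀ t ∈ Finset.range T,
      ∫ ω, roundRegret T0 T1 active (fun i t => W i t ω) (fun a t => X a t ω) mean t ∂(cond P G) ≤
      ((if t % T1 < T0 then (K : ℝ) else 0) +
        (if t / T1 ∈ changingEpochs active T T1 then (K : ℝ) else 0)) +
        (if T0 ≤ t % T1 then (K : ℝ) * (K * q ^ (t % T1 - T0)) else 0) := by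
    intro t ht
    have hpos : 0 ≤ (K : ℝ) * (K * q ^ (t % T1 - T0)) := by positivity
    have hK0 : (0 : ℝ) ≤ K := Nat.cast_nonneg K
    have htriv : ∫ ω, roundRegret T0 T1 active (fun i t => W i t ω) (fun a t => X a t ω) mean t
        ∂(cond P G) ≤ K := by
      refine (integral_mono (hint t) (integrable_const (K : ℝ))
        fun ω => roundRegret_le h0 h1).trans ?_
      simp
    by_cases hl : t % T1 < T0
    · rw [if_pos hl, if_neg (not_le.2 hl)]
      split_ifs <;> linarith
    · rw [if_neg hl, if_pos (not_lt.1 hl)]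
      split_ifs with hd
      · linarith
      · have := h.integral_roundRegret_le h0 h1 hNm hgap hs hT hT1 (Finset.mem_range.1 ht)
          (not_lt.1 hl) hd hG
        linarith
  refine (Finset.sum_le_sum hround).trans ?_
  rw [Finset.sum_add_distrib, Finset.sum_add_distrib, ← Finset.sum_filter, ← Finset.sum_filter,
    ← Finset.sum_filter, Finset.sum_const, Finset.sum_const, ← Finset.mul_sum, ← Finset.mul_sum,
    nsmul_eq_mul, nsmul_eq_mul]
  have hA : (((Finset.range T).filter fun t => t % T1 < T0).card : ℝ) ≤ numEpochs T T1 * T0 := by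
    exact_mod_cast card_learning_rounds_le hT1
  have hB : (((Finset.range T).filter fun t => t / T1 ∈ changingEpochs active T T1).card : ℝ) ≤
      min ((x : ℝ) * min (T1 : ℝ) T) T := by
    apply le_min
    · have := (card_rounds_of_epochs_le (T := T) hT1 (changingEpochs active T T1)).trans
        (Nat.mul_le_mul_right _ hs.card_changingEpochs_le)
      exact_mod_cast this
    · have := (Finset.card_filter_le (Finset.range T)
        fun t => t / T1 ∈ changingEpochs active T T1).trans_eq (Finset.card_range T)
      exact_mod_cast this
  have hC := sum_geometric_rounds_le (T := T) (T0 := T0) hT1 hq0 hq1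
  -- The sum of the series is `eK`, the mean waiting time at success probability `1/(eK)`.
  have hinv : (1 - q)⁻¹ ≤ 3 * K := by
    rw [hq, sub_sub_cancel, inv_div, div_le_iff₀ (Real.exp_pos _)]
    nlinarith
  calc _ ≤ numEpochs T T1 * T0 * K + min ((x : ℝ) * min (T1 : ℝ) T) T * K +
        K * (K * (numEpochs T T1 * (3 * K))) := by
        gcongr
        exact hC.trans (by gcongr)
    _ = _ := by ring

end Regret

/-! ### Explicit constants for the soft-O bounds -/

section SoftO

variable {K Nm T x T0 T1 : ℕ} {ε δ : ℝ}

theorem log_div_nonneg (hT : 1 ≤ T) (hδ : 0 < δ) (hδ1 : δ < 1) : 0 ≤ Real.log (T / δ) := by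
  apply Real.log_nonneg
  rw [one_le_div hδ]
  have : (1 : ℝ) ≤ T := by exact_mod_cast hT
  linarith

theorem sq_le_softFactor (hT : 1 ≤ T) (hε : 0 < ε) (hδ : 0 < δ) (hδ1 : δ < 1) :
    (K : ℝ) ^ 2 ≤ softFactor 1 2 2 1 K T ε δ := by
  have hL := log_div_nonneg hT hδ hδ1
  have h1 : 1 ≤ (1 + 1 / ε) ^ 2 := one_le_pow₀ (by linarith [show 0 < 1 / ε by positivity])
  rw [softFactor, one_mul, pow_one, mul_assoc]
  exact le_mul_of_one_le_right (by positivity) (by nlinarith)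

/-- Bounding `log K` by `K - 1` costs a factor `K`, still within `K^2`. The collision term gives `2
/ 0.02 = 100`, and the ceiling adds one. -/
theorem learningRounds_le (hK : 1 ≤ K) (hT : 1 ≤ T) (hε : 0 < ε) (hδ : 0 < δ) (hδ1 : δ < 1) :
    (learningRounds K T ε δ : ℝ) ≤ 101 * softFactor 1 2 2 1 K T ε δ := by
  have hK' : (1 : ℝ) ≤ K := by exact_mod_cast hK
  have hT' : (1 : ℝ) ≤ T := by exact_mod_cast hT
  have hL := log_div_nonneg hT hδ hδ1
  have hsoft := sq_le_softFactor (K := K) hT hε hδ hδ1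
  set F := softFactor 1 2 2 1 K T ε δ with hF
  set L := Real.log (T / δ) with hLdef
  have hFeq : F = (K : ℝ) ^ 2 * (1 + 1 / ε) ^ 2 * (1 + L) := by
    rw [hF, softFactor, one_mul, pow_one]
  have hTδ : 0 < (T : ℝ) / δ := by positivity
  have hlog2 := Real.log_two_lt_d9
  have hlogK : Real.log K ≤ K - 1 := Real.log_le_sub_one_of_pos (by linarith)
  have hKL : (K : ℝ) ^ 2 * (1 + L) ≤ F := by
    rw [hFeq]
    have h1 : 1 ≤ (1 + 1 / ε) ^ 2 := one_le_pow₀ (by linarith [show 0 < 1 / ε by positivity])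
    gcongr
    exact le_mul_of_one_le_right (by positivity) h1
  have h4 : Real.log (4 * T / δ) ≤ 2 * (1 + L) := by
    rw [mul_div_assoc, Real.log_mul (by norm_num) hTδ.ne', show (4 : ℝ) = 2 ^ 2 by norm_num,
      Real.log_pow]
    push_cast
    linarith
  have h8 : Real.log (4 * (K : ℝ) ^ 2 / (δ / (2 * T))) ≤ 3 * K * (1 + L) := by
    have : 4 * (K : ℝ) ^ 2 / (δ / (2 * T)) = 2 ^ 3 * (K : ℝ) ^ 2 * (T / δ) := by
      field_simp; norm_num
    rw [this, Real.log_mul (by positivity) hTδ.ne', Real.log_mul (by positivity) (by positivity),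
      Real.log_pow, Real.log_pow]
    push_cast
    nlinarith
  have h8' : Real.log (2 * (K : ℝ) ^ 2 / (δ / (2 * T))) ≤ 3 * K * (1 + L) := by
    refine le_trans (Real.log_le_log (by positivity) ?_) h8
    gcongr
    norm_num
  refine (Nat.ceil_lt_add_one ?_).le.trans ?_
  · refine le_trans ?_ ((le_max_right _ _).trans (le_max_right _ _))
    have := one_lt_four_mul_div hT hδ hδ1
    have := Real.log_nonneg (by linarith : 1 ≤ 4 * (T : ℝ) / δ)
    positivity
  · have hmax : max ((K : ℝ) / 2 * Real.log (2 * (K : ℝ) ^ 2 / (δ / (2 * T))))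
        (max (16 * (K : ℝ) / ε ^ 2 * Real.log (4 * (K : ℝ) ^ 2 / (δ / (2 * T))))
        ((K : ℝ) ^ 2 * Real.log (4 * T / δ) / 0.02)) ≤ 100 * F := by
      refine max_le ?_ (max_le ?_ ?_)
      · calc (K : ℝ) / 2 * Real.log (2 * (K : ℝ) ^ 2 / (δ / (2 * T)))
            ≤ K / 2 * (3 * K * (1 + L)) := by gcongr
          _ = 3 / 2 * (K ^ 2 * (1 + L)) := by ring
          _ ≤ 100 * F := by
            have : 0 ≤ (K : ℝ) ^ 2 * (1 + L) := by positivity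
            linarith
      · calc 16 * (K : ℝ) / ε ^ 2 * Real.log (4 * (K : ℝ) ^ 2 / (δ / (2 * T)))
            ≤ 16 * (K : ℝ) / ε ^ 2 * (3 * K * (1 + L)) := by gcongr
          _ = 48 * (K ^ 2 * (1 / ε) ^ 2 * (1 + L)) := by
            rw [div_pow]; field_simp; norm_num
          _ ≤ 48 * (K ^ 2 * (1 + 1 / ε) ^ 2 * (1 + L)) := by
            gcongr
            linarith
          _ ≤ 100 * F := by
            rw [← hFeq]
            linarith [sq_nonneg (K : ℝ)]
      · rw [div_le_iff₀ (by norm_num)]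
        calc (K : ℝ) ^ 2 * Real.log (4 * T / δ) ≤ K ^ 2 * (2 * (1 + L)) := by gcongr
          _ = 2 * (K ^ 2 * (1 + L)) := by ring
          _ ≤ 100 * F * 0.02 := by linarith
    have h1F : 1 ≤ F := le_trans (one_le_pow₀ hK') hsoft
    linarith

theorem softFactor_le_softFactor {C c : ℝ} (hK : 1 ≤ K) (hT : 1 ≤ T) (hε : 0 < ε) (hδ : 0 < δ)
    (hδ1 : δ < 1) (hC : c ≤ C) :
    c * K ^ 3 * softFactor 1 2 2 1 K T ε δ ≤ softFactor C 5 2 1 K T ε δ := by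
  have hL := log_div_nonneg hT hδ hδ1
  have : softFactor C 5 2 1 K T ε δ = C * K ^ 3 * softFactor 1 2 2 1 K T ε δ := by
    simp only [softFactor]; ring
  rw [this]
  have : 0 ≤ softFactor 1 2 2 1 K T ε δ :=
    (sq_nonneg (K : ℝ)).trans (sq_le_softFactor hT hε hδ hδ1)
  gcongr

theorem one_le_sqrt_mul (hT : 1 ≤ T) (hx : 1 ≤ x) : 1 ≤ Real.sqrt ((x : ℝ) * T) := by
  rw [Real.one_le_sqrt]
  exact_mod_cast Nat.mul_le_mul hx hT

/-- Since `T0 ≥ 1`, the length is at least `√(T/x)`. The ceiling adds one, absorbed by `√(xT) ≥ 1`.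
-/
theorem numEpochs_epochLength_le {Tf : ℝ} (hT : 1 ≤ T) (hx : 1 ≤ x) (hT0 : 1 ≤ T0)
    (hTf : 0 ≤ Tf) :
    (numEpochs T (epochLength T0 T x Tf) : ℝ) ≤ 2 * Real.sqrt (x * T) := by
  have hT' : (0 : ℝ) < T := by exact_mod_cast hT
  have hx' : (0 : ℝ) < x := by exact_mod_cast hx
  have hT0' : (1 : ℝ) ≤ T0 := by exact_mod_cast hT0
  have hlen : Real.sqrt (T / x) ≤ epochLength T0 T x Tf := by
    calc Real.sqrt (T / x) ≤ Real.sqrt ((T : ℝ) * (T0 + 2 * Tf) / x) := by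
          apply Real.sqrt_le_sqrt
          gcongr
          exact le_mul_of_one_le_right hT'.le (by linarith)
      _ ≤ (⌈Real.sqrt ((T : ℝ) * (T0 + 2 * Tf) / x)⌉₊ : ℝ) := Nat.le_ceil _
      _ ≤ _ := by
          rw [epochLength]
          exact_mod_cast le_max_right _ _
  have hpos : 0 < Real.sqrt ((T : ℝ) / x) := Real.sqrt_pos.2 (by positivity)
  have h1 : (T : ℝ) / epochLength T0 T x Tf ≤ Real.sqrt (x * T) := by
    rw [div_le_iff₀ (hpos.trans_le hlen)]
    calc (T : ℝ) = Real.sqrt (x * T) * Real.sqrt (T / x) := by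
          rw [← Real.sqrt_mul (by positivity), show (x : ℝ) * T * (T / x) = T ^ 2 by field_simp,
            Real.sqrt_sq hT'.le]
      _ ≤ _ := by gcongr
  have h2 := (Nat.ceil_lt_add_one (show 0 ≤ (T : ℝ) / epochLength T0 T x Tf by positivity)).le
  have h3 := one_le_sqrt_mul hT hx
  rw [numEpochs]
  linarith

theorem epochLength_le {Tf : ℝ} :
    (epochLength T0 T x Tf : ℝ) ≤
      T0 + 1 + Real.sqrt (T / x) * Real.sqrt (T0 + 2 * Tf) := by
  rw [← Real.sqrt_mul (by positivity), div_mul_eq_mul_div, epochLength, Nat.cast_max]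
  have h1 := (Nat.ceil_lt_add_one (Real.sqrt_nonneg ((T : ℝ) * (T0 + 2 * Tf) / x))).le
  have h2 : (0 : ℝ) ≤ T0 := Nat.cast_nonneg _
  have h3 := Real.sqrt_nonneg ((T : ℝ) * (T0 + 2 * Tf) / x)
  exact max_le (by linarith) (by linarith)

theorem sqrt_mul_sqrt_div (hx : 1 ≤ x) :
    Real.sqrt ((x : ℝ) * T) * Real.sqrt (T / x) = T := by
  have hx' : (0 : ℝ) < x := by exact_mod_cast hx
  rw [← Real.sqrt_mul (by positivity), show (x : ℝ) * T * (T / x) = T ^ 2 by field_simp,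
    Real.sqrt_sq (Nat.cast_nonneg T)]

theorem mul_sqrt_div (hx : 1 ≤ x) :
    (x : ℝ) * Real.sqrt (T / x) = Real.sqrt (x * T) := by
  have hx' : (0 : ℝ) < x := by exact_mod_cast hx
  rw [Real.sqrt_div (Nat.cast_nonneg T), Real.sqrt_mul hx'.le, mul_div_assoc', mul_comm,
    mul_div_assoc, mul_comm]
  congr 1
  rw [div_eq_iff (Real.sqrt_pos.2 hx').ne', Real.mul_self_sqrt hx'.le]

/-- From `√y ≤ y + 1` and `e² ≤ 7.5` the left side is at most `2 * T0 + 2 + 15 * K`, whence `2c +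
17`. -/
theorem length_factor_le {Tf F c : ℝ} (hK : 1 ≤ K) (hF : (K : ℝ) ^ 2 ≤ F) (hT0 : (T0 : ℝ) ≤ c * F)
    (hTf : 0 ≤ Tf) (hTfK : Tf ≤ Real.exp 2 * K) :
    T0 + 1 + Real.sqrt (T0 + 2 * Tf) ≤ (2 * c + 17) * F := by
  have hK' : (1 : ℝ) ≤ K := by exact_mod_cast hK
  have hKF : (K : ℝ) ≤ F := le_trans (by nlinarith) hF
  have he : Real.exp 2 ≤ 7.5 := by
    have h1 := Real.exp_one_lt_d9
    have h0 := Real.exp_pos 1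
    rw [show (2 : ℝ) = 1 + 1 by norm_num, Real.exp_add]
    nlinarith
  have h1 : Tf ≤ 7.5 * K := hTfK.trans (by gcongr)
  have h2 : (0 : ℝ) ≤ T0 := Nat.cast_nonneg _
  have h3 : Real.sqrt (T0 + 2 * Tf) ≤ T0 + 2 * Tf + 1 := by
    apply Real.sqrt_le_iff.2
    constructor <;> nlinarith
  linarith

/-- Multiplied by the epoch length, `√(xT)` is at most `F * T`; the summand `T0 + 1` of the length
is handled by `√(xT) ≤ T`, valid for `x ≤ T`. -/
theorem sqrt_le_mul_numEpochs {Tf F : ℝ} (hT : 1 ≤ T) (hx : 1 ≤ x) (hxT : x ≤ T) (hT0 : 1 ≤ T0)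
    (hTf : 0 ≤ Tf) (hF : T0 + 1 + Real.sqrt (T0 + 2 * Tf) ≤ F) :
    Real.sqrt (x * T) ≤ F * numEpochs T (epochLength T0 T x Tf) := by
  have hT' : (0 : ℝ) < T := by exact_mod_cast hT
  have hsT : Real.sqrt ((x : ℝ) * T) ≤ T := by
    apply Real.sqrt_le_iff.2 ⟨hT'.le, ?_⟩
    have : (x : ℝ) ≤ T := by exact_mod_cast hxT
    nlinarith
  have hlen : (0 : ℝ) < epochLength T0 T x Tf := by
    have : T0 ≤ epochLength T0 T x Tf := le_max_left _ _
    exact_mod_cast hT0.trans this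
  have hF0 : 0 ≤ F := le_trans (by positivity) hF
  have hkey : Real.sqrt (x * T) * epochLength T0 T x Tf ≤ F * T := by
    calc Real.sqrt (x * T) * epochLength T0 T x Tf
        ≤ Real.sqrt (x * T) * (T0 + 1 + Real.sqrt (T / x) * Real.sqrt (T0 + 2 * Tf)) := by
          gcongr
          exact epochLength_le
      _ = Real.sqrt (x * T) * (T0 + 1) + T * Real.sqrt (T0 + 2 * Tf) := by
          rw [mul_add, ← mul_assoc, sqrt_mul_sqrt_div hx]
      _ ≤ T * (T0 + 1) + T * Real.sqrt (T0 + 2 * Tf) := by gcongr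
      _ = (T0 + 1 + Real.sqrt (T0 + 2 * Tf)) * T := by ring
      _ ≤ F * T := by gcongr
  calc Real.sqrt (x * T) ≤ F * T / epochLength T0 T x Tf := by rwa [le_div_iff₀ hlen]
    _ = F * (T / epochLength T0 T x Tf) := mul_div_assoc _ _ _
    _ ≤ _ := by
      gcongr
      exact Nat.le_ceil _

/-- For `x ≤ T` this is `x * √(T/x) = √(xT)` together with `x ≤ √(xT)`; for `x ≥ T` already `T ≤
√(xT)`. -/
theorem changing_rounds_le_of_epochLength {Tf F : ℝ} (hx : 1 ≤ x)
    (hF : T0 + 1 + Real.sqrt (T0 + 2 * Tf) ≤ F) (hF1 : 1 ≤ F) :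
    min ((x : ℝ) * min (epochLength T0 T x Tf : ℝ) T) T ≤ F * Real.sqrt (x * T) := by
  have hs := Real.sqrt_nonneg ((x : ℝ) * T)
  rcases le_total x T with hxT | hxT
  · have hx0 : (x : ℝ) ≤ Real.sqrt (x * T) := by
      apply Real.le_sqrt_of_sq_le
      have : (x : ℝ) ≤ T := by exact_mod_cast hxT
      nlinarith [Nat.cast_nonneg (α := ℝ) x]
    calc min ((x : ℝ) * min (epochLength T0 T x Tf : ℝ) T) T
        ≤ x * epochLength T0 T x Tf := (min_le_left _ _).trans (by gcongr; exact min_le_left _ _)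
      _ ≤ x * (T0 + 1 + Real.sqrt (T / x) * Real.sqrt (T0 + 2 * Tf)) := by
          gcongr
          exact epochLength_le
      _ = x * (T0 + 1) + Real.sqrt (x * T) * Real.sqrt (T0 + 2 * Tf) := by
          rw [mul_add, ← mul_assoc, mul_sqrt_div hx]
      _ ≤ Real.sqrt (x * T) * (T0 + 1) + Real.sqrt (x * T) * Real.sqrt (T0 + 2 * Tf) := by gcongr
      _ = (T0 + 1 + Real.sqrt (T0 + 2 * Tf)) * Real.sqrt (x * T) := by ring
      _ ≤ _ := by gcongr
  · have hT0 : (T : ℝ) ≤ Real.sqrt (x * T) := by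
      apply Real.le_sqrt_of_sq_le
      have : (T : ℝ) ≤ x := by exact_mod_cast hxT
      nlinarith [Nat.cast_nonneg (α := ℝ) T]
    exact (min_le_right _ _).trans (hT0.trans (le_mul_of_one_le_left hs hF1))

/-- Many epochs force short ones: `min T1 T` times their number is at most `2T`, the `2` accounting
for an incomplete last epoch. -/
theorem changing_rounds_le_of_numEpochs {a : ℝ} (ha : 0 < a) (hT : 1 ≤ T) (hx : 1 ≤ x)
    (hT1 : 1 ≤ T1) (hM : a * Real.sqrt (x * T) ≤ numEpochs T T1) :
    min ((x : ℝ) * min (T1 : ℝ) T) T ≤ 2 / a * Real.sqrt (x * T) := by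
  have hT' : (0 : ℝ) < T := by exact_mod_cast hT
  have hT1' : (0 : ℝ) < T1 := by exact_mod_cast hT1
  have hs := one_le_sqrt_mul hT hx
  have hmin : min (T1 : ℝ) T * numEpochs T T1 ≤ 2 * T := by
    rcases le_total T1 T with h | h
    · have h' : (T1 : ℝ) ≤ T := by exact_mod_cast h
      rw [min_eq_left h']
      have h1 : (numEpochs T T1 : ℝ) ≤ T / T1 + 1 := (Nat.ceil_lt_add_one (by positivity)).le
      calc (T1 : ℝ) * numEpochs T T1 ≤ T1 * (T / T1 + 1) := by gcongr
        _ = T + T1 := by field_simp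
        _ ≤ 2 * T := by linarith
    · have h' : (T : ℝ) ≤ T1 := by exact_mod_cast h
      rw [min_eq_right h']
      have h1 : numEpochs T T1 ≤ 1 := by
        rw [numEpochs, Nat.ceil_le, Nat.cast_one, div_le_one hT1']
        exact h'
      have h2 : (numEpochs T T1 : ℝ) ≤ 1 := by exact_mod_cast h1
      nlinarith
  have hmin0 : 0 ≤ min (T1 : ℝ) T := by positivity
  have h1 : min (T1 : ℝ) T * (a * Real.sqrt (x * T)) ≤ 2 * T :=
    (mul_le_mul_of_nonneg_left hM hmin0).trans hmin
  refine (min_le_left _ _).trans ?_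
  rw [div_mul_eq_mul_div, le_div_iff₀ ha]
  refine le_of_mul_le_mul_right ?_ (by linarith : 0 < Real.sqrt ((x : ℝ) * T))
  have hsq : Real.sqrt ((x : ℝ) * T) * Real.sqrt (x * T) = x * T :=
    Real.mul_self_sqrt (by positivity)
  calc (x : ℝ) * min (T1 : ℝ) T * a * Real.sqrt (x * T)
      = x * (min (T1 : ℝ) T * (a * Real.sqrt (x * T))) := by ring
    _ ≤ x * (2 * T) := by gcongr
    _ = 2 * Real.sqrt (x * T) * Real.sqrt (x * T) := by
      rw [mul_assoc, hsq]; ring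

end SoftO

end DMC

/-! ### Assembly of the theorem -/

open DMC in
theorem theorem2 :
    ∃ p q r : ℕ, ∀ a b : ℝ, 0 < a → 0 < b → ∃ C : ℝ, 0 < C ∧
      ∀ (K : ℕ) [NeZero K] (Nm T x : ℕ) (ε δ : ℝ), Nm ≤ K → 1 ≤ T → 1 ≤ x → 0 < ε →
        0 < δ → δ < 1 →
        -- the learning phases have soft-O(1) rounds
        (learningRounds K T ε δ : ℝ) ≤ softFactor C p q r K T ε δ ∧
        -- the optimized epoch length gives order √(xT) epochs, up to the hidden factors
        (∀ Tf : ℝ, 0 ≤ Tf → Tf ≤ Real.exp 2 * K →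
          (numEpochs T (epochLength (learningRounds K T ε δ) T x Tf) : ℝ)
            ≤ C * Real.sqrt (x * T) ∧
          (x ≤ T → Real.sqrt (x * T) ≤ softFactor C p q r K T ε δ *
            numEpochs T (epochLength (learningRounds K T ε δ) T x Tf))) ∧
        -- for that epoch length, and for each one giving between a√(xT) and b√(xT) epochs,
        -- the regret is soft-O(√(xT))
        ∀ T1 : ℕ, learningRounds K T ε δ ≤ T1 →
          ((a * Real.sqrt (x * T) ≤ numEpochs T T1 ∧ numEpochs T T1 ≤ b * Real.sqrt (x * T)) ∨
            ∃ Tf : ℝ, 0 ≤ Tf ∧ Tf ≤ Real.exp 2 * K ∧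
              T1 = epochLength (learningRounds K T ε δ) T x Tf) →
          ∀ (Ω ι : Type*) [MeasurableSpace Ω] [DecidableEq ι] (P : Measure Ω)
            [IsProbabilityMeasure P] (ν : Fin K → Measure ℝ) (X : Fin K → ℕ → Ω → ℝ)
            (W : ι → ℕ → Ω → ℝ) (active : ℕ → Finset ι) (mean : Fin K → ℝ),
            IsModel P ν X W →
            (∀ k, mean k = ∫ y, y ∂(ν k)) →
            -- consecutive arms among the best Nm + 1 have gap at least ε
            (∀ (j : ℕ) (hj : j + 1 < K), j < Nm →
              ε ≤ mean (ranking mean ⟨j, Nat.lt_of_succ_lt hj⟩) -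
                mean (ranking mean ⟨j + 1, hj⟩)) →
            IsSchedule active Nm T x (learningRounds K T ε δ) T1 →
            1 - δ ≤ P.real (goodEvent mean ε T (learningRounds K T ε δ) T1 active X W) ∧
            Integrable (fun ω => regret (learningRounds K T ε δ) T1 active
                (fun i t => W i t ω) (fun k t => X k t ω) mean T)
              (cond P (goodEvent mean ε T (learningRounds K T ε δ) T1 active X W)) ∧
            ∫ ω, regret (learningRounds K T ε δ) T1 active
                (fun i t => W i t ω) (fun k t => X k t ω) mean T
              ∂(cond P (goodEvent mean ε T (learningRounds K T ε δ) T1 active X W))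
              ≤ softFactor C p q r K T ε δ * Real.sqrt (x * T) := by
  -- The exponents are those of `T0`, with three more powers of `K` from Musical Chairs. In the
  -- constant, `b + 2` bounds the number of epochs in both cases, and `219 = 2 * 101 + 17` comes
  -- from `length_factor_le`.
  refine ⟨5, 2, 1, fun a b ha hb =>
    ⟨103 * (b + 2) + (2 / a + 219) + 3 * (b + 2), by positivity, ?_⟩⟩
  intro K _ Nm T x ε δ hNm hT hx hε hδ hδ1
  set C : ℝ := 103 * (b + 2) + (2 / a + 219) + 3 * (b + 2) with hC
  have ha2 : 0 < 2 / a := by positivity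
  have hK : 1 ≤ K := NeZero.one_le
  have hK' : (1 : ℝ) ≤ K := by exact_mod_cast hK
  have hK3 : (1 : ℝ) ≤ (K : ℝ) ^ 3 := one_le_pow₀ hK'
  have hsq := sq_le_softFactor (K := K) hT hε hδ hδ1
  have hT0F := learningRounds_le hK hT hε hδ hδ1
  have hT01 : 1 ≤ learningRounds K T ε δ := hK.trans (le_learningRounds hK hT hδ hδ1)
  set F := softFactor 1 2 2 1 K T ε δ with hFdef
  set T0 := learningRounds K T ε δ with hT0
  have hF1 : 1 ≤ F := (one_le_pow₀ hK').trans hsq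
  have hsoft : ∀ c : ℝ, 0 ≤ c → c ≤ C → c * F ≤ softFactor C 5 2 1 K T ε δ := fun c hc hcC =>
    (mul_le_mul_of_nonneg_right (le_mul_of_one_le_right hc hK3) (by linarith)).trans
      (softFactor_le_softFactor hK hT hε hδ hδ1 hcC)
  have hs := one_le_sqrt_mul hT hx
  refine ⟨hT0F.trans (hsoft _ (by norm_num) (by linarith)),
    fun Tf hTf hTfK => ⟨?_, fun hxT => ?_⟩, ?_⟩
  · refine (numEpochs_epochLength_le hT hx hT01 hTf).trans ?_
    gcongr
    linarith
  · exact sqrt_le_mul_numEpochs hT hx hxT hT01 hTf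
      ((length_factor_le hK hsq hT0F hTf hTfK).trans (hsoft _ (by norm_num) (by linarith)))
  intro T1 hT1 hcase Ω ι _ _ P _ ν X W active mean hmodel hmean hgap hsched
  have hT1pos : 1 ≤ T1 := hT01.trans hT1
  have hgood := hmodel.one_sub_le_goodEvent hmean hT hε hδ hδ1 hT0 hT1 hNm hsched
  have h0 : ∀ k, 0 ≤ mean k := fun k => hmean k ▸ (hmodel.mean_mem_Icc k).1
  have h1 : ∀ k, mean k ≤ 1 := fun k => hmean k ▸ (hmodel.mean_mem_Icc k).2
  obtain ⟨hint, hreg⟩ := hmodel.integral_regret_le h0 h1 hNm hgap hsched hT1 hT1pos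
    (lt_of_lt_of_le (by linarith) hgood)
  refine ⟨hgood, hint, hreg.trans ?_⟩
  have hM : (numEpochs T T1 : ℝ) ≤ (b + 2) * Real.sqrt (x * T) := by
    rcases hcase with ⟨-, h⟩ | ⟨Tf, hTf, -, rfl⟩
    · refine h.trans ?_
      gcongr
      linarith
    · refine (numEpochs_epochLength_le hT hx hT01 hTf).trans ?_
      gcongr
      linarith
  have hD : min ((x : ℝ) * min (T1 : ℝ) T) T ≤ (2 / a + 219) * F * Real.sqrt (x * T) := by
    rcases hcase with ⟨h, -⟩ | ⟨Tf, hTf, hTfK, rfl⟩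
    · refine (changing_rounds_le_of_numEpochs ha hT hx hT1pos h).trans ?_
      gcongr
      nlinarith
    · refine (changing_rounds_le_of_epochLength (F := (2 / a + 219) * F) hx ?_ ?_)
      · refine (length_factor_le hK hsq hT0F hTf hTfK).trans
          (mul_le_mul_of_nonneg_right (by linarith) (by linarith))
      · nlinarith
  have hKK : (K : ℝ) ≤ K ^ 3 := le_self_pow₀ hK' (by norm_num)
  have hF0 : 0 ≤ F := by linarith
  calc (K : ℝ) * (numEpochs T T1 * T0) + K * min ((x : ℝ) * min (T1 : ℝ) T) T +
        3 * K ^ 3 * numEpochs T T1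
      ≤ K ^ 3 * ((b + 2) * Real.sqrt (x * T) * (101 * F)) +
        K ^ 3 * ((2 / a + 219) * F * Real.sqrt (x * T)) +
        3 * K ^ 3 * (((b + 2) * Real.sqrt (x * T)) * F) := by
        gcongr
        exact hM.trans (le_mul_of_one_le_right (by positivity) hF1)
    _ = (101 * (b + 2) + (2 / a + 219) + 3 * (b + 2)) * K ^ 3 * F * Real.sqrt (x * T) := by ring
    _ ≤ softFactor C 5 2 1 K T ε δ * Real.sqrt (x * T) := by
        gcongr
        exact softFactor_le_softFactor hK hT hε hδ hδ1 (by linarith)
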